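/- Let $N,n\ge 1$ be integers, $\tau,\eta,c\in\mathbb C$ with $\operatorname{Im}\tau>0$, $c\neq0$. Let $$\vartheta(z)=-\sum_{j\in\mathbb Z}\exp\Big(\pi\imath\tau\big(j+\tfrac12\big)^2+2\pi\imath\big(j+\tfrac12\big)\big(z+\tfrac12\big)\Big),\quad \phi(z,u)=\frac{\vartheta'(0)\,\vartheta(z+u)}{\vartheta(z)\,\vartheta(u)},\quad E_1(u)=\frac{\vartheta'(u)}{\vartheta(u)} .$$ On the phase space $\mathbb C^{2Nn}$ with coordinates $q_i^a,p_i^a$ ($i=1,\dots,N$; $a=1,\dots,n$, the index $a$ being taken modulo $n$) consider the canonical Poisson bracket $\{p_i^a,q_j^b\}=\delta^{ab}\delta_{ij}$, $\{p_i^a,p_j^b\}=\{q_i^a,q_j^b\}=0$. The periodic elliptic Ruijsenaars chain has the $N\times N$ Lax matrices $$L^a_{ij}(z)=\phi(z,q_i^{a-1}-q_j^a+\eta)\,\frac{\prod_{l=1}^N\vartheta(q_j^a-q_l^{a-1}-\eta)}{\vartheta(-\eta)\prod_{l\ne j}\vartheta(q_j^a-q_l^a)}\,e^{p_j^a/c},\qquad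 a=1,\dots,n,$$ and the monodromy matrix $T(z)=L^1(z)L^2(z)\cdots L^n(z)$. Write $A_1=A\otimes 1_N$, $A_2=1_N\otimes A$, $E_{ij}$ for the matrix units, and $\{A_1,B_2\}=\sum_{i,j,k,l}\{A_{ij},B_{kl}\}\,E_{ij}\otimes E_{kl}$. Put $$r^a_{12}(z,w)=\sum_{i\ne j}\phi(z-w,q_i^a-q_j^a)E_{ij}\otimes E_{ji}+E_1(z-w)\sum_iE_{ii}\otimes E_{ii}-\sum_{i\neq j}E_1(q_i^a-q_j^a)E_{ii}\otimes E_{jj},$$ $$s^{+,1}_{12}(z)=s^1_{12}(z)+\sum_{i,j}E_1(q_j^{n}-q_i^1+\eta)E_{ii}\otimes E_{jj},\qquad s^{-,1}_{12}(w)=s^1_{21}(w)+\sum_{i,j}E_1(q_i^{n}-q_j^1+\eta)E_{ii}\otimes E_{jj},$$ where $s^1_{12}(z)$, $s^1_{21}(w)$ are determined by $$L^1_1(z)s^1_{12}(z)=\sum_{i,j}L^1_{ij}(z)\big(E_1(z+q_i^n-q_j^1+\eta)-E_1(q_i^n-q_j^1+\eta)\big)E_{ij}\otimes E_{ii},$$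 $$L^1_2(w)s^1_{21}(w)=\sum_{i,j}L^1_{ij}(w)\big(E_1(w+q_i^n-q_j^1+\eta)-E_1(q_i^n-q_j^1+\eta)\big)E_{ii}\otimes E_{ij},$$ and let $$\breve s^{+,1}_{12}(z,w)=L^1_1(z)\,s^{+,1}_{12}(z)\,\big(L^1_1(z)\big)^{-1},\qquad \breve s^{-,1}_{12}(z,w)=L^1_2(w)\,s^{-,1}_{12}(w)\,\big(L^1_2(w)\big)^{-1}.$$ Then the entries of $T(z)$ and $T(w)$ are differentiable in $(q,p)$ and $$c\,\{T_1(z),T_2(w)\}=T_1(z)T_2(w)\,r^n_{12}(z,w)-\big(r^n_{12}(z,w)-\breve s^{+,1}_{12}(z,w)+\breve s^{-,1}_{12}(z,w)\big)T_1(z)T_2(w)+T_1(z)\,\breve s^{-,1}_{12}(z,w)\,T_2(w)-T_2(w)\,\breve s^{+,1}_{12}(z,w)\,T_1(z)$$ at every point $(q,p)$ and for all $z,w\in\mathbb C$ at which all these expressions are defined, that is, whenever $\vartheta$ does not vanish at $\eta$, $z$, $w$, $z-w$, at $q_i^a-q_j^a$ ($i\ne j$), at $q_i^{a-1}-q_j^a+\eta$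 (all $a,i,j$), at $z+q_i^n-q_j^1+\eta$ and $w+q_i^n-q_j^1+\eta$ (all $i,j$), and the matrices $L^1(z)$ and $L^1(w)$ are invertible. -/

import Mathlib

open scoped Kronecker

noncomputable section

namespace RuijsenaarsChain

/-! ### Elliptic functions -/

/-- The theta function with characteristics `a, b` and modular parameter `τ`. -/
def thetaChar (a b τ z : ℂ) : ℂ :=
  ∑' j : ℤ, Complex.exp
    (2 * Real.pi * Complex.I * ((j : ℂ) + a) ^ 2 * (τ / 2) +
      2 * Real.pi * Complex.I * ((j : ℂ) + a) * (z + b))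

/-- The odd (first Jacobi) theta function. -/
def theta (τ z : ℂ) : ℂ := -thetaChar (1 / 2) (1 / 2) τ z

/-- The elliptic Kronecker function `ϑ'(0) ϑ(z + u) / (ϑ(z) ϑ(u))`. -/
def phi (τ z u : ℂ) : ℂ :=
  deriv (theta τ) 0 * theta τ (z + u) / (theta τ z * theta τ u)

/-- The first Eisenstein function `ϑ'(u) / ϑ(u)`. -/
def E1 (τ u : ℂ) : ℂ := deriv (theta τ) u / theta τ u

/-! ### Phase space and canonical Poisson bracket -/

/-- The phase space `ℂ^{2Nn}`. A point is a pair `(q, p)`, where `q a i` and `p a i` are the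
position and the momentum of the `i`-th particle at site `a`; sites are numbered modulo `n`, so
that site `0` is site `n`. -/
abbrev Phase (N n : ℕ) : Type := (ZMod n → Fin N → ℂ) × (ZMod n → Fin N → ℂ)

variable {N n : ℕ} [NeZero n]

/-- The partial derivative `∂f / ∂q_i^a` at `x`. -/
def dq (a : ZMod n) (i : Fin N) (f : Phase N n → ℂ) (x : Phase N n) : ℂ :=
  fderiv ℂ f x (Pi.single a (Pi.single i 1), 0)

/-- The partial derivative `∂f / ∂p_i^a` at `x`. -/
def dp (a : ZMod n) (i : Fin N) (f : Phase N n → ℂ) (x : Phase N n) : ℂ :=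
  fderiv ℂ f x (0, Pi.single a (Pi.single i 1))

/-- The canonical Poisson bracket, normalized by `{p_i^a, q_j^b} = δ^{ab} δ_{ij}`. -/
def poisson (f g : Phase N n → ℂ) (x : Phase N n) : ℂ :=
  ∑ a : ZMod n, ∑ i : Fin N, (dp a i f x * dq a i g x - dq a i f x * dp a i g x)

/-! ### Tensor notation: `Mat(N, ℂ) ⊗ Mat(N, ℂ)` through the Kronecker product -/

/-- Elements of `Mat(N, ℂ) ⊗ Mat(N, ℂ)`. -/
abbrev Mat2 (N : ℕ) : Type := Matrix (Fin N × Fin N) (Fin N × Fin N) ℂ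

/-- `E_{ij} ⊗ E_{kl}`, the tensor product of matrix units. -/
def EE (i j k l : Fin N) : Mat2 N :=
  Matrix.single i j (1 : ℂ) ⊗ₖ Matrix.single k l (1 : ℂ)

/-- `A_1 = A ⊗ 1_N`. -/
def in1 (A : Matrix (Fin N) (Fin N) ℂ) : Mat2 N := A ⊗ₖ (1 : Matrix (Fin N) (Fin N) ℂ)

/-- `A_2 = 1_N ⊗ A`. -/
def in2 (A : Matrix (Fin N) (Fin N) ℂ) : Mat2 N := (1 : Matrix (Fin N) (Fin N) ℂ) ⊗ₖ A

/-- `{A_1, B_2} = ∑ {A_{ij}, B_{kl}} E_{ij} ⊗ E_{kl}` at the point `x`. -/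
def bracket12 (A B : Phase N n → Matrix (Fin N) (Fin N) ℂ) (x : Phase N n) : Mat2 N :=
  ∑ i, ∑ j, ∑ k, ∑ l, poisson (fun y => A y i j) (fun y => B y k l) x • EE i j k l

/-! ### The Ruijsenaars chain -/

/-- The coefficient `b_j^a`. -/
def coeffB (τ η c : ℂ) (a : ZMod n) (x : Phase N n) (j : Fin N) : ℂ :=
  (∏ l, theta τ (x.1 a j - x.1 (a - 1) l - η)) /
    (theta τ (-η) * ∏ l ∈ Finset.univ.erase j, theta τ (x.1 a j - x.1 a l)) *
    Complex.exp (x.2 a j / c)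

/-- The Lax matrix `L^a(z)`. -/
def lax (τ η c : ℂ) (a : ZMod n) (z : ℂ) (x : Phase N n) : Matrix (Fin N) (Fin N) ℂ :=
  Matrix.of fun i j => phi τ z (x.1 (a - 1) i - x.1 a j + η) * coeffB τ η c a x j

/-- The monodromy matrix `T(z) = L^1(z) L^2(z) ⋯ L^n(z)`. -/
def monodromy (τ η c z : ℂ) (x : Phase N n) : Matrix (Fin N) (Fin N) ℂ :=
  (List.ofFn fun k : Fin n => lax τ η c (((k : ℕ) : ZMod n) + 1) z x).prod

/-! ### The `r`-matrices -/

/-- The matrix `r^a_{12}(z, w)`. -/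
def r12 (τ : ℂ) (a : ZMod n) (z w : ℂ) (x : Phase N n) : Mat2 N :=
  (∑ i, ∑ j ∈ Finset.univ.erase i, phi τ (z - w) (x.1 a i - x.1 a j) • EE i j j i) +
    E1 τ (z - w) • ∑ i, EE i i i i -
    ∑ i, ∑ j ∈ Finset.univ.erase i, E1 τ (x.1 a i - x.1 a j) • EE i i j j

/-- The matrix `u^{+,a}_{12}`. -/
def uPlus (τ η : ℂ) (a : ZMod n) (x : Phase N n) : Mat2 N :=
  ∑ i, ∑ j, E1 τ (x.1 (a - 1) j - x.1 a i + η) • EE i i j j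

/-- The matrix `u^{-,a}_{12}`. -/
def uMinus (τ η : ℂ) (a : ZMod n) (x : Phase N n) : Mat2 N :=
  -∑ i, ∑ j, E1 τ (x.1 (a - 1) i - x.1 a j + η) • EE i i j j

/-- The entries of the `η`-derivative of `L^a(z)` that acts on the Kronecker function only. -/
def dEtaLax (τ η c : ℂ) (a : ZMod n) (z : ℂ) (x : Phase N n) (i j : Fin N) : ℂ :=
  lax τ η c a z x i j *
    (E1 τ (z + x.1 (a - 1) i - x.1 a j + η) - E1 τ (x.1 (a - 1) i - x.1 a j + η))

/-- The matrix `s^a_{12}(z)`, the solution of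
`L^a_1(z) s^a_{12}(z) = ∑ dEtaLax_{ij}(z) E_{ij} ⊗ E_{ii}`. -/
def s12 (τ η c : ℂ) (a : ZMod n) (z : ℂ) (x : Phase N n) : Mat2 N :=
  (in1 (lax τ η c a z x))⁻¹ * ∑ i, ∑ j, dEtaLax τ η c a z x i j • EE i j i i

/-- The matrix `s^a_{21}(w)`, the solution of
`L^a_2(w) s^a_{21}(w) = ∑ dEtaLax_{ij}(w) E_{ii} ⊗ E_{ij}`. -/
def s21 (τ η c : ℂ) (a : ZMod n) (w : ℂ) (x : Phase N n) : Mat2 N :=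
  (in2 (lax τ η c a w x))⁻¹ * ∑ i, ∑ j, dEtaLax τ η c a w x i j • EE i i i j

/-- The matrix `s^{+,a}_{12}(z)`. -/
def sPlus (τ η c : ℂ) (a : ZMod n) (z : ℂ) (x : Phase N n) : Mat2 N :=
  s12 τ η c a z x + uPlus τ η a x

/-- The matrix `s^{-,a}_{12}(w)`. -/
def sMinus (τ η c : ℂ) (a : ZMod n) (w : ℂ) (x : Phase N n) : Mat2 N :=
  s21 τ η c a w x - uMinus τ η a x

/-- The matrix `s^{+,1}_{12}` conjugated by `L^1_1(z)`. -/
def sBrevePlus (τ η c z : ℂ) (x : Phase N n) : Mat2 N :=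
  in1 (lax τ η c 1 z x) * sPlus τ η c 1 z x * (in1 (lax τ η c 1 z x))⁻¹

/-- The matrix `s^{-,1}_{12}` conjugated by `L^1_2(w)`. -/
def sBreveMinus (τ η c w : ℂ) (x : Phase N n) : Mat2 N :=
  in2 (lax τ η c 1 w x) * sMinus τ η c 1 w x * (in2 (lax τ η c 1 w x))⁻¹

end RuijsenaarsChain

end

open RuijsenaarsChain

/-!
The proof differentiates the monodromy matrix factor by factor and sums the resulting terms along
the chain.

Only `L^a` depends on `p^a`, and `∂ L^a / ∂ p_k^a = c⁻¹ L^a E_{kk}`, while `q^a` enters only `L^a`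
and the cyclically next factor `L^{a+1}`. Hence the bracket is a sum over sites of dressed terms of
two kinds (`smul_bracket12_eq`): `rightTerm`, in which `p^a` and `q^a` are both taken in `L^a`, and
`leftTerm`, in which `p^a` is taken in `L^a` and `q^a` in `L^{a+1}`. Together they satisfy
the local exchange relation
`rightTerm + leftTerm = L^a_1 L^a_2 r^a_{12} - r^{a-1}_{12} L^a_1 L^a_2`
(`rightTerm_add_leftTerm`), so that the dressed `r`-matrices telescope (`sum_local_eq`) to
`T_1 T_2 r^n_{12} - r^n_{12} T_1 T_2`. The exception is the site `n`, where the chain closes: the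
factors `L^n` and `L^1` are not adjacent in the monodromy matrix, so the telescoping sum contains a
`leftTerm` for `L^1` that has to be subtracted, and the true contribution is `closingTerm`. The
matrices `s^±` are made so that `L^1_1(z) s^{+,1}_{12}(z)` and `L^1_2(w) s^{-,1}_{12}(w)` collect
the derivatives of `L^1` in `q^n` (`in1_lax_mul_sPlus`, `in2_lax_mul_sMinus`), which turns these two
corrections into the terms with `s̆^±`.

Entrywise the local exchange relation amounts to two relations between products of two Kronecker
functions (`phi_mul_phi_mul_E1`, `phiDeriv_mul_phi_sub`). Both follow from the three-term identity of
Weierstrass for the theta function (`theta_three_term`) and its infinitesimal form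
(`deriv_theta_four_term`). The three-term identity holds because
`ϑ(x + y) ϑ(x - y) = F(x) G(y) - G(x) F(y)`, which is seen by multiplying out the two series and
sorting the frequencies by parity (`theta_add_mul_theta_sub`).

The hypotheses allow `ϑ(z + q_i^{a-1} - q_j^a + η) = 0` at sites `a ≠ 1`. The derivative of the
Kronecker function is therefore written as `phiDeriv`, without a quotient by this value, and
`deriv_theta_four_term` has its denominators cleared.
-/

open scoped Kronecker

noncomputable section

namespace RuijsenaarsChain

section

/-! ### The three-term identity of the theta function and its derivative -/

/-- The `j`-th term of the series of `-theta τ z`. -/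
def thetaTerm (τ : ℂ) (j : ℤ) (z : ℂ) : ℂ :=
  Complex.exp (2 * Real.pi * Complex.I * ((j : ℂ) + 1 / 2) ^ 2 * (τ / 2) +
      2 * Real.pi * Complex.I * ((j : ℂ) + 1 / 2) * (z + 1 / 2))

theorem theta_eq_tsum (τ z : ℂ) : theta τ z = -∑' j : ℤ, thetaTerm τ j z := rfl

theorem thetaTerm_eq (τ : ℂ) (j : ℤ) (z : ℂ) :
    thetaTerm τ j z = Complex.exp (Real.pi * Complex.I * τ / 4 + Real.pi * Complex.I * (z + 1 / 2)) *
      jacobiTheta₂_term j (z + 1 / 2 + τ / 2) τ := by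
  rw [thetaTerm, jacobiTheta₂_term, ← Complex.exp_add]
  congr 1
  ring

theorem theta_eq_jacobiTheta₂ (τ z : ℂ) :
    theta τ z = -(Complex.exp (Real.pi * Complex.I * τ / 4 + Real.pi * Complex.I * (z + 1 / 2)) *
      jacobiTheta₂ (z + 1 / 2 + τ / 2) τ) := by
  rw [theta_eq_tsum, jacobiTheta₂, ← tsum_mul_left]
  simp_rw [thetaTerm_eq]

theorem summable_thetaTerm {τ : ℂ} (hτ : 0 < τ.im) (z : ℂ) :
    Summable fun j => thetaTerm τ j z := by
  simp_rw [thetaTerm_eq]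
  exact ((summable_jacobiTheta₂_term_iff _ _).2 hτ).mul_left _

theorem differentiable_theta {τ : ℂ} (hτ : 0 < τ.im) : Differentiable ℂ (theta τ) := by
  have h : theta τ = fun z =>
      -(Complex.exp (Real.pi * Complex.I * τ / 4 + Real.pi * Complex.I * (z + 1 / 2)) *
        jacobiTheta₂ (z + 1 / 2 + τ / 2) τ) := funext (theta_eq_jacobiTheta₂ τ)
  rw [h]
  intro z
  refine DifferentiableAt.neg (DifferentiableAt.mul (by fun_prop) ?_)
  exact DifferentiableAt.comp (g := fun z => jacobiTheta₂ z τ) z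
    (differentiableAt_jacobiTheta₂_fst _ hτ) (by fun_prop)

theorem hasDerivAt_theta {τ : ℂ} (hτ : 0 < τ.im) (z : ℂ) :
    HasDerivAt (theta τ) (deriv (theta τ) z) z :=
  (differentiable_theta hτ z).hasDerivAt

theorem exp_pi_I_mul_odd (r : ℤ) :
    Complex.exp (Real.pi * Complex.I * (2 * r + 1)) = -1 := by
  have : (Real.pi * Complex.I * (2 * r + 1) : ℂ) =
      Real.pi * Complex.I + r * (2 * Real.pi * Complex.I) := by ring
  rw [this, Complex.exp_add, Complex.exp_int_mul_two_pi_mul_I, Complex.exp_pi_mul_I, mul_one]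

theorem exp_pi_I_mul_even (r : ℤ) :
    Complex.exp (Real.pi * Complex.I * (2 * r)) = 1 := by
  have : (Real.pi * Complex.I * (2 * r) : ℂ) = r * (2 * Real.pi * Complex.I) := by ring
  rw [this, Complex.exp_int_mul_two_pi_mul_I]

theorem theta_neg (τ z : ℂ) : theta τ (-z) = -theta τ z := by
  rw [theta_eq_tsum, theta_eq_tsum, ← (Equiv.subLeft (-1 : ℤ)).tsum_eq, neg_inj, ← tsum_neg]
  refine tsum_congr fun j => ?_
  have h := exp_pi_I_mul_odd (-(j + 1))
  rw [thetaTerm, thetaTerm, neg_eq_neg_one_mul (Complex.exp _), ← h, ← Complex.exp_add]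
  congr 1
  -- The reflection `j ↦ -1 - j` negates the half-integers `j + 1 / 2`.
  simp only [Equiv.subLeft_apply]
  push_cast
  ring

theorem deriv_theta_neg (τ z : ℂ) : deriv (theta τ) (-z) = deriv (theta τ) z := by
  have h : (fun u => theta τ (-u)) = fun u => -theta τ u := funext (theta_neg τ)
  have h2 := congrArg (fun f => deriv f z) h
  simp only [deriv.fun_neg, deriv_comp_neg] at h2
  exact neg_injective h2

/-- The sum over the even frequencies of the theta series with parameter `τ / 2`. -/
def thetaEven (τ x : ℂ) : ℂ := ∑' r : ℤ, jacobiTheta₂_term (2 * r) x (τ / 2)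

/-- The sum over the odd frequencies of the theta series with parameter `τ / 2`. -/
def thetaOdd (τ x : ℂ) : ℂ := ∑' r : ℤ, jacobiTheta₂_term (2 * r + 1) x (τ / 2)

theorem thetaTerm_mul_thetaTerm (τ x y : ℂ) (j k : ℤ) :
    thetaTerm τ j (x + y) * thetaTerm τ k (x - y) =
      Complex.exp (Real.pi * Complex.I * (j + k + 1)) *
        (jacobiTheta₂_term (j + k + 1) x (τ / 2) * jacobiTheta₂_term (j - k) y (τ / 2)) := by
  simp only [thetaTerm, jacobiTheta₂_term, ← Complex.exp_add]
  congr 1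
  push_cast
  ring

/-- Pairs of integers, split by the parity of the difference. -/
def parityEquiv : (ℤ × ℤ) ⊕ (ℤ × ℤ) ≃ ℤ × ℤ :=
  Equiv.ofBijective
    (Sum.elim (fun p => (p.1 + p.2, p.1 - p.2 - 1)) (fun p => (p.1 + p.2, p.1 - p.2))) <| by
    constructor
    · rintro (⟨a, b⟩ | ⟨a, b⟩) (⟨c, d⟩ | ⟨c, d⟩) h <;>
        simp only [Sum.elim_inl, Sum.elim_inr, Prod.mk.injEq] at h
      · obtain ⟨rfl, rfl⟩ : a = c ∧ b = d := by omega
        rfl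
      · omega
      · omega
      · obtain ⟨rfl, rfl⟩ : a = c ∧ b = d := by omega
        rfl
    · rintro ⟨j, k⟩
      rcases Int.even_or_odd' (j - k) with ⟨s, hs | hs⟩
      · exact ⟨Sum.inr (k + s, s), by simp only [Sum.elim_inr, Prod.mk.injEq]; omega⟩
      · exact ⟨Sum.inl (k + s + 1, s), by simp only [Sum.elim_inl, Prod.mk.injEq]; omega⟩

theorem parityEquiv_inl (r s : ℤ) : parityEquiv (Sum.inl (r, s)) = (r + s, r - s - 1) := rfl

theorem parityEquiv_inr (r s : ℤ) : parityEquiv (Sum.inr (r, s)) = (r + s, r - s) := rfl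

/-- Multiplying out the two series and collecting frequencies by parity separates the variables. -/
theorem theta_add_mul_theta_sub {τ : ℂ} (hτ : 0 < τ.im) (x y : ℂ) :
    theta τ (x + y) * theta τ (x - y) =
      thetaEven τ x * thetaOdd τ y - thetaOdd τ x * thetaEven τ y := by
  have hτ2 : 0 < (τ / 2).im := by
    simpa using hτ
  have hT : ∀ u, Summable fun m => jacobiTheta₂_term m u (τ / 2) := fun u =>
    (summable_jacobiTheta₂_term_iff _ _).2 hτ2
  have hE : ∀ u, Summable fun r : ℤ => jacobiTheta₂_term (2 * r) u (τ / 2) := fun u =>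
    (hT u).comp_injective (i := fun r : ℤ => 2 * r) fun a b h => by simpa using h
  have hO : ∀ u, Summable fun r : ℤ => jacobiTheta₂_term (2 * r + 1) u (τ / 2) := fun u =>
    (hT u).comp_injective (i := fun r : ℤ => 2 * r + 1) fun a b h => by simpa using h
  rw [theta_eq_tsum, theta_eq_tsum, neg_mul_neg, tsum_mul_tsum_of_summable_norm
    (summable_thetaTerm hτ (x + y)).norm (summable_thetaTerm hτ (x - y)).norm,
    ← parityEquiv.tsum_eq, thetaEven, thetaOdd, thetaOdd, thetaEven,
    tsum_mul_tsum_of_summable_norm (hE x).norm (hO y).norm,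
    tsum_mul_tsum_of_summable_norm (hO x).norm (hE y).norm, sub_eq_add_neg _ (tsum _), ← tsum_neg]
  refine (HasSum.sum
    ((summable_mul_of_summable_norm (hE x).norm (hO y).norm).hasSum.congr_fun ?_)
    ((summable_mul_of_summable_norm (hO x).norm (hE y).norm).neg.hasSum.congr_fun ?_)).tsum_eq
  · rintro ⟨r, s⟩
    have h1 : r + s + (r - s - 1) + 1 = 2 * r := by ring
    have h2 : r + s - (r - s - 1) = 2 * s + 1 := by ring
    have h3 := congrArg (Int.cast (R := ℂ)) h1
    push_cast at h3
    simp only [Function.comp_apply, parityEquiv_inl]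
    rw [thetaTerm_mul_thetaTerm, h1, h2]
    push_cast
    rw [h3, exp_pi_I_mul_even, one_mul]
  · rintro ⟨r, s⟩
    have h1 : r + s + (r - s) + 1 = 2 * r + 1 := by ring
    have h2 : r + s - (r - s) = 2 * s := by ring
    have h3 := congrArg (Int.cast (R := ℂ)) h1
    push_cast at h3
    simp only [Function.comp_apply, parityEquiv_inr]
    rw [thetaTerm_mul_thetaTerm, h1, h2]
    push_cast
    rw [h3, exp_pi_I_mul_odd, neg_one_mul]

/-- The three-term identity of Weierstrass: it is the Plücker relation for the brackets
`theta τ (x + y) * theta τ (x - y)`. -/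
theorem theta_three_term {τ : ℂ} (hτ : 0 < τ.im) (x y u v : ℂ) :
    theta τ (x + y) * theta τ (x - y) * (theta τ (u + v) * theta τ (u - v)) -
      theta τ (x + u) * theta τ (x - u) * (theta τ (y + v) * theta τ (y - v)) +
      theta τ (x + v) * theta τ (x - v) * (theta τ (y + u) * theta τ (y - u)) = 0 := by
  simp only [theta_add_mul_theta_sub hτ]
  ring

/-- The three-term identity, arranged as the antisymmetrization of a product of four theta
functions under a common shift, so that its first order in `t` is a relation between logarithmic
derivatives. -/
theorem theta_shift_identity {τ : ℂ} (hτ : 0 < τ.im) {a b c d : ℂ} (h : a + b + c + d = 0) (t : ℂ) :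
    theta τ (a + t) * theta τ (b + t) * theta τ (c + t) * theta τ (d + t) -
      theta τ (a - t) * theta τ (b - t) * theta τ (c - t) * theta τ (d - t) =
      -(theta τ (2 * t) * theta τ (a + b) * theta τ (a + c) * theta τ (b + c)) := by
  -- In these half-sums the twelve arguments become the shifted `a, b, c, d` and the pairwise sums.
  have H := theta_three_term hτ ((a + b) / 2 + t) ((a - b) / 2) ((c - d) / 2) ((c + d) / 2 + t)
  have e1 : (a + b) / 2 + t + (a - b) / 2 = a + t := by ring
  have e2 : (a + b) / 2 + t - (a - b) / 2 = b + t := by ring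
  have e3 : (c - d) / 2 + ((c + d) / 2 + t) = c + t := by ring
  have e4 : (c - d) / 2 - ((c + d) / 2 + t) = -(d + t) := by ring
  have e5 : (a + b) / 2 + t + (c - d) / 2 = -(d - t) := by linear_combination h / 2
  have e6 : (a + b) / 2 + t - (c - d) / 2 = -(c - t) := by linear_combination h / 2
  have e7 : (a - b) / 2 + ((c + d) / 2 + t) = -(b - t) := by linear_combination h / 2
  have e8 : (a - b) / 2 - ((c + d) / 2 + t) = a - t := by linear_combination -h / 2
  have e9 : (a + b) / 2 + t + ((c + d) / 2 + t) = 2 * t := by linear_combination h / 2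
  have e10 : (a + b) / 2 + t - ((c + d) / 2 + t) = a + b := by linear_combination -h / 2
  have e11 : (a - b) / 2 + (c - d) / 2 = a + c := by linear_combination -h / 2
  have e12 : (a - b) / 2 - (c - d) / 2 = -(b + c) := by linear_combination h / 2
  rw [e1, e2, e3, e4, e5, e6, e7, e8, e9, e10, e11, e12] at H
  simp only [theta_neg] at H
  linear_combination -H

/-- The four-term relation between logarithmic derivatives of `theta τ`, with denominators cleared
so that it also holds at the zeros. -/
theorem deriv_theta_four_term {τ : ℂ} (hτ : 0 < τ.im) {a b c d : ℂ} (h : a + b + c + d = 0) :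
    deriv (theta τ) a * theta τ b * theta τ c * theta τ d +
      theta τ a * deriv (theta τ) b * theta τ c * theta τ d +
      theta τ a * theta τ b * deriv (theta τ) c * theta τ d +
      theta τ a * theta τ b * theta τ c * deriv (theta τ) d =
      -(deriv (theta τ) 0 * theta τ (a + b) * theta τ (a + c) * theta τ (b + c)) := by
  have hp : ∀ u : ℂ, HasDerivAt (fun t => theta τ (u + t)) (deriv (theta τ) u) 0 := fun u => by
    have := hasDerivAt_theta hτ (u + 0)
    simpa using this.comp_const_add u 0
  have hm : ∀ u : ℂ, HasDerivAt (fun t => theta τ (u - t)) (-deriv (theta τ) u) 0 := fun u => by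
    have := hasDerivAt_theta hτ (u - 0)
    simpa using this.comp_const_sub u 0
  have h2 : HasDerivAt (fun t => theta τ (2 * t)) (deriv (theta τ) 0 * 2) 0 := by
    have h0 : HasDerivAt (theta τ) (deriv (theta τ) 0) (2 * 0) := by
      simpa using hasDerivAt_theta hτ 0
    exact h0.comp 0 (by simpa using (hasDerivAt_id (0 : ℂ)).const_mul 2)
  have hl := ((((hp a).mul (hp b)).mul (hp c)).mul (hp d)).sub
    ((((hm a).mul (hm b)).mul (hm c)).mul (hm d))
  have hr := (((h2.mul_const (theta τ (a + b))).mul_const (theta τ (a + c))).mul_const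
    (theta τ (b + c))).neg
  have he := hl.unique (hr.congr_of_eventuallyEq
    (Filter.Eventually.of_forall fun t => theta_shift_identity hτ h t))
  simp only [Pi.mul_apply, add_zero, sub_zero] at he
  linear_combination he / 2

end

section

variable {N n : ℕ}

/-! ### Relations for the Kronecker function -/

theorem E1_neg (τ u : ℂ) : E1 τ (-u) = -E1 τ u := by
  rw [E1, E1, deriv_theta_neg, theta_neg, div_neg]

/-- The derivative of `phi τ z` at `u`, in a form that is also right where `theta τ (z + u) = 0`. -/
def phiDeriv (τ z u : ℂ) : ℂ :=
  deriv (theta τ) 0 * (deriv (theta τ) (z + u) * theta τ u - theta τ (z + u) * deriv (theta τ) u) /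
    (theta τ z * theta τ u ^ 2)

theorem hasDerivAt_phi {τ : ℂ} (hτ : 0 < τ.im) {z u : ℂ} (hz : theta τ z ≠ 0)
    (hu : theta τ u ≠ 0) : HasDerivAt (phi τ z) (phiDeriv τ z u) u := by
  have h := ((((hasDerivAt_theta hτ (z + u)).comp_const_add z u).const_mul (deriv (theta τ) 0))).div
    ((hasDerivAt_theta hτ u).const_mul (theta τ z)) (mul_ne_zero hz hu)
  refine h.congr_deriv ?_
  rw [phiDeriv]
  field_simp

theorem phiDeriv_eq_phi_mul {τ z u : ℂ} (hu : theta τ u ≠ 0) (hzu : theta τ (z + u) ≠ 0) :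
    phiDeriv τ z u = phi τ z u * (E1 τ (z + u) - E1 τ u) := by
  rw [phiDeriv, phi, E1, E1]
  by_cases hz : theta τ z = 0
  · simp [hz]
  field_simp

/-- The relation between products of two Kronecker functions behind the entries of the local
exchange relation with four distinct indices. -/
theorem phi_mul_phi_mul_E1 {τ : ℂ} (hτ : 0 < τ.im) {z w A α β : ℂ} (hz : theta τ z ≠ 0)
    (hw : theta τ w ≠ 0) (hzw : theta τ (z - w) ≠ 0) (hA : theta τ A ≠ 0) (hα : theta τ α ≠ 0)
    (hβ : theta τ β ≠ 0) (hAα : theta τ (A - α) ≠ 0) (hAβ : theta τ (A - β) ≠ 0)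
    (hAαβ : theta τ (A - α - β) ≠ 0) :
    phi τ z A * phi τ w (A - α - β) *
        (E1 τ α - E1 τ β + E1 τ (A - α) - E1 τ (A - β)) =
      phi τ (z - w) α * phi τ z (A - α) * phi τ w (A - β) -
        phi τ (z - w) β * phi τ z (A - β) * phi τ w (A - α) := by
  -- The combination of `E1` factorizes; what is left is the three-term identity.
  have hE : (E1 τ α - E1 τ β + E1 τ (A - α) - E1 τ (A - β)) =
      -(deriv (theta τ) 0 * theta τ A * theta τ (α - β) * theta τ (A - α - β)) /
        (theta τ α * theta τ β * theta τ (A - α) * theta τ (A - β)) := by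
    have h := deriv_theta_four_term hτ (show α + (A - α) + (-β) + (-(A - β)) = 0 by ring)
    rw [show α + (A - α) = A by ring, show α + -β = α - β by ring,
      show A - α + -β = A - α - β by ring] at h
    simp only [theta_neg, deriv_theta_neg] at h
    simp only [E1]
    field_simp
    linear_combination h
  have hT := theta_three_term hτ ((z + w + 2 * A - α - β) / 2) ((z - w + α + β) / 2)
    ((z - w + α - β) / 2) ((z - w - α + β) / 2)
  rw [show (z + w + 2 * A - α - β) / 2 + (z - w + α + β) / 2 = z + A by ring,
    show (z + w + 2 * A - α - β) / 2 - (z - w + α + β) / 2 = w + (A - α - β) by ring,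
    show (z - w + α - β) / 2 + (z - w - α + β) / 2 = z - w by ring,
    show (z - w + α - β) / 2 - (z - w - α + β) / 2 = α - β by ring,
    show (z + w + 2 * A - α - β) / 2 + (z - w + α - β) / 2 = z + (A - β) by ring,
    show (z + w + 2 * A - α - β) / 2 - (z - w + α - β) / 2 = w + (A - α) by ring,
    show (z - w + α + β) / 2 + (z - w - α + β) / 2 = z - w + β by ring,
    show (z - w + α + β) / 2 - (z - w - α + β) / 2 = α by ring,
    show (z + w + 2 * A - α - β) / 2 + (z - w - α + β) / 2 = z + (A - α) by ring,
    show (z + w + 2 * A - α - β) / 2 - (z - w - α + β) / 2 = w + (A - β) by ring,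
    show (z - w + α + β) / 2 + (z - w + α - β) / 2 = z - w + α by ring,
    show (z - w + α + β) / 2 - (z - w + α - β) / 2 = β by ring] at hT
  rw [hE]
  simp only [phi]
  field_simp
  linear_combination -(deriv (theta τ) 0 ^ 3 ) * hT

/-- The relation between products of two Kronecker functions behind the entries of the local
exchange relation with two coinciding indices. -/
theorem phiDeriv_mul_phi_sub {τ : ℂ} (hτ : 0 < τ.im) {z w A D : ℂ} (hz : theta τ z ≠ 0)
    (hw : theta τ w ≠ 0) (hzw : theta τ (z - w) ≠ 0) (hA : theta τ A ≠ 0) (hD : theta τ D ≠ 0)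
    (hAD : theta τ (A - D) ≠ 0) :
    phiDeriv τ z A * phi τ w D - phi τ z A * phiDeriv τ w D +
        phi τ z A * phi τ w D * (E1 τ A - E1 τ D) =
      phi τ z A * phi τ w D * (E1 τ (z - w) + E1 τ (A - D)) -
        phi τ (z - w) (A - D) * phi τ z D * phi τ w A := by
  have h := deriv_theta_four_term hτ
    (show (z + A) + (-(w + D)) + (-(z - w)) + (-(A - D)) = 0 by ring)
  rw [show z + A + -(w + D) = (z - w) + (A - D) by ring, show z + A + -(z - w) = w + A by ring,
      show -(w + D) + -(z - w) = -(z + D) by ring] at h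
  simp only [theta_neg, deriv_theta_neg] at h
  simp only [phi, phiDeriv, E1]
  field_simp
  linear_combination -(deriv (theta τ) 0 ^ 2 * theta τ A * theta τ D) * h

/-! ### Entries of the tensor matrices -/

theorem EE_apply (i j k l : Fin N) (p q : Fin N × Fin N) :
    EE i j k l p q = if p = (i, k) ∧ q = (j, l) then 1 else 0 := by
  obtain ⟨p1, p2⟩ := p
  obtain ⟨q1, q2⟩ := q
  simp only [EE, Matrix.kroneckerMap_apply, Matrix.single_apply, Prod.mk.injEq, mul_ite, mul_one,
    mul_zero, ← ite_and]
  congr 1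
  apply propext
  constructor <;> rintro ⟨⟨rfl, rfl⟩, rfl, rfl⟩ <;> simp

theorem sum_smul_EE_swap_apply (g : Fin N → Fin N → ℂ) (i k j l : Fin N) :
    (∑ a, ∑ b, g a b • EE a b b a) (i, k) (j, l) = if i = l ∧ k = j then g i k else 0 := by
  simp only [Matrix.sum_apply, Matrix.smul_apply, EE_apply, Prod.mk.injEq, smul_eq_mul]
  rw [Finset.sum_eq_single i, Finset.sum_eq_single k]
  · simp [and_comm, eq_comm]
  all_goals first | (intro b _ hb; simp [hb.symm]) | simp

theorem sum_smul_EE_diag_apply (g : Fin N → Fin N → ℂ) (i k j l : Fin N) :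
    (∑ a, ∑ b, g a b • EE a a b b) (i, k) (j, l) = if i = j ∧ k = l then g i k else 0 := by
  simp only [Matrix.sum_apply, Matrix.smul_apply, EE_apply, Prod.mk.injEq, smul_eq_mul]
  rw [Finset.sum_eq_single i, Finset.sum_eq_single k]
  · simp [eq_comm]
  all_goals first | (intro b _ hb; simp [hb.symm]) | simp

theorem sum_smul_EE_left_apply (g : Fin N → Fin N → ℂ) (i k j l : Fin N) :
    (∑ a, ∑ b, g a b • EE a b a a) (i, k) (j, l) = if i = k ∧ k = l then g i j else 0 := by
  simp only [Matrix.sum_apply, Matrix.smul_apply, EE_apply, Prod.mk.injEq, smul_eq_mul]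
  rw [Finset.sum_eq_single i, Finset.sum_eq_single j]
  · simp only [true_and]
    aesop
  all_goals first | (intro b _ hb; simp [hb.symm]) | simp

theorem sum_smul_EE_right_apply (g : Fin N → Fin N → ℂ) (i k j l : Fin N) :
    (∑ a, ∑ b, g a b • EE a a a b) (i, k) (j, l) = if i = k ∧ i = j then g k l else 0 := by
  simp only [Matrix.sum_apply, Matrix.smul_apply, EE_apply, Prod.mk.injEq, smul_eq_mul]
  rw [Finset.sum_eq_single i, Finset.sum_eq_single l]
  · aesop
  all_goals first | (intro b _ hb; simp [hb.symm]) | simp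

theorem sum_smul_EE_apply (g : Fin N → Fin N → Fin N → Fin N → ℂ) (i k j l : Fin N) :
    (∑ a, ∑ b, ∑ c, ∑ d, g a b c d • EE a b c d) (i, k) (j, l) = g i j k l := by
  simp only [Matrix.sum_apply, Matrix.smul_apply, EE_apply, Prod.mk.injEq, smul_eq_mul]
  rw [Finset.sum_eq_single i, Finset.sum_eq_single j, Finset.sum_eq_single k,
    Finset.sum_eq_single l]
  · simp
  all_goals first | (intro b _ hb; simp [hb.symm]) | simp

/-- The permutation part and the diagonal part of the `r`-matrix, entry by entry; they do not
overlap, as the first one vanishes when all four indices coincide. -/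
theorem r12_apply (τ : ℂ) (a : ZMod n) (z w : ℂ) (x : Phase N n) (i k j l : Fin N) :
    r12 τ a z w x (i, k) (j, l) =
      (if i = l ∧ k = j then (if l = j then 0 else phi τ (z - w) (x.1 a l - x.1 a j)) else 0) +
      (if i = j ∧ k = l then (if j = l then E1 τ (z - w) else -E1 τ (x.1 a j - x.1 a l)) else 0) := by
  have hdiag : E1 τ (z - w) • ∑ i : Fin N, EE i i i i =
      ∑ i, ∑ j, (if j = i then E1 τ (z - w) else 0) • EE i i j j := by
    simp [Finset.smul_sum, ite_smul]
  have herase : ∀ (g : Fin N → Fin N → ℂ) (M : Fin N → Fin N → Mat2 N),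
      ∑ i, ∑ j ∈ Finset.univ.erase i, g i j • M i j =
        ∑ i, ∑ j, (if j = i then 0 else g i j) • M i j := fun g M => by
    refine Finset.sum_congr rfl fun i _ => ?_
    rw [← Finset.filter_ne', Finset.sum_filter]
    refine Finset.sum_congr rfl fun j _ => ?_
    by_cases h : j = i <;> simp [h]
  rw [r12, hdiag, herase, herase, Matrix.sub_apply, Matrix.add_apply, sum_smul_EE_swap_apply,
    sum_smul_EE_diag_apply, sum_smul_EE_diag_apply]
  by_cases h1 : i = l ∧ k = j <;> by_cases h2 : i = j ∧ k = l
  · obtain ⟨rfl, rfl⟩ := h1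
    obtain ⟨rfl, -⟩ := h2
    simp
  · obtain ⟨rfl, rfl⟩ := h1
    have h3 : i ≠ k := fun h => h2 ⟨h, h.symm⟩
    simp [h3, h3.symm]
  · obtain ⟨rfl, rfl⟩ := h2
    by_cases h3 : i = k
    · simp [h3]
    · simp [h3, Ne.symm h3]
  · simp [h1, h2]

theorem mul_r12_apply (M : Mat2 N) (τ : ℂ) (a : ZMod n) (z w : ℂ) (x : Phase N n)
    (p : Fin N × Fin N) (j l : Fin N) :
    (M * r12 τ a z w x) p (j, l) =
      M p (l, j) * (if l = j then 0 else phi τ (z - w) (x.1 a l - x.1 a j)) +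
      M p (j, l) * (if j = l then E1 τ (z - w) else -E1 τ (x.1 a j - x.1 a l)) := by
  simp only [Matrix.mul_apply, Fintype.sum_prod_type, r12_apply, mul_add, Finset.sum_add_distrib,
    ite_and, mul_ite, mul_zero, Finset.sum_ite_eq', Finset.sum_ite_irrel, Finset.sum_const_zero,
    Finset.mem_univ, if_true]

theorem r12_mul_apply (M : Mat2 N) (τ : ℂ) (a : ZMod n) (z w : ℂ) (x : Phase N n)
    (q : Fin N × Fin N) (i k : Fin N) :
    (r12 τ a z w x * M) (i, k) q =
      (if i = k then 0 else phi τ (z - w) (x.1 a i - x.1 a k)) * M (k, i) q +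
      (if i = k then E1 τ (z - w) else -E1 τ (x.1 a i - x.1 a k)) * M (i, k) q := by
  simp only [Matrix.mul_apply, Fintype.sum_prod_type, r12_apply, add_mul, Finset.sum_add_distrib]
  congr 1
  · rw [Finset.sum_eq_single k, Finset.sum_eq_single i]
    · simp
    all_goals first | (intro b _ hb; simp [hb.symm]) | simp
  · rw [Finset.sum_eq_single i, Finset.sum_eq_single k]
    · simp
    all_goals first | (intro b _ hb; simp [hb.symm]) | simp

end

section

variable {N n : ℕ}

/-! ### The local exchange relation -/

/-- The part of `∂ L^a(z) / ∂ q_k^{a-1}` that comes from the dependence of `L^a(z)` on the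
positions at site `a - 1`; for `n = 1` this differs from the full derivative. -/
def laxDerivLeft (τ η c : ℂ) (a : ZMod n) (z : ℂ) (x : Phase N n) (k : Fin N) :
    Matrix (Fin N) (Fin N) ℂ :=
  Matrix.of fun i j =>
    (if i = k then phiDeriv τ z (x.1 (a - 1) i - x.1 a j + η) * coeffB τ η c a x j else 0) +
      lax τ η c a z x i j * E1 τ (x.1 (a - 1) k - x.1 a j + η)

/-- The derivative of `log b_j^a` in `q_j^a`, with the positions at site `a - 1` held fixed. -/
def logDerivB (τ η : ℂ) (a : ZMod n) (x : Phase N n) (j : Fin N) : ℂ :=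
  ∑ l, E1 τ (x.1 a j - x.1 (a - 1) l - η) - ∑ l ∈ Finset.univ.erase j, E1 τ (x.1 a j - x.1 a l)

/-- The part of `∂ L^a(z) / ∂ q_k^a` that comes from the dependence of `L^a(z)` on the positions
at site `a`. -/
def laxDerivRight (τ η c : ℂ) (a : ZMod n) (z : ℂ) (x : Phase N n) (k : Fin N) :
    Matrix (Fin N) (Fin N) ℂ :=
  Matrix.of fun i j =>
    if j = k then -(phiDeriv τ z (x.1 (a - 1) i - x.1 a j + η) * coeffB τ η c a x j) +
        lax τ η c a z x i j * logDerivB τ η a x j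
      else lax τ η c a z x i j * E1 τ (x.1 a j - x.1 a k)

/-- The diagonal matrix unit `E_{kk}`. -/
def diagUnit (k : Fin N) : Matrix (Fin N) (Fin N) ℂ := Matrix.single k k 1

theorem mul_diagUnit_apply (A : Matrix (Fin N) (Fin N) ℂ) (k i j : Fin N) :
    (A * diagUnit k) i j = if j = k then A i j else 0 := by
  rw [diagUnit, Matrix.mul_apply, Finset.sum_eq_single j]
  · by_cases h : j = k
    · simp [h]
    · simp [h, Ne.symm h]
  · intro b _ hb
    simp [Matrix.single_apply]
    aesop
  · simp

theorem diagUnit_mul_apply (A : Matrix (Fin N) (Fin N) ℂ) (k i j : Fin N) :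
    (diagUnit k * A) i j = if i = k then A i j else 0 := by
  rw [diagUnit, Matrix.mul_apply, Finset.sum_eq_single i]
  · by_cases h : i = k
    · simp [h]
    · simp [h, Ne.symm h]
  · intro b _ hb
    simp [Matrix.single_apply]
    aesop
  · simp

theorem in1_mul_in2 (A B : Matrix (Fin N) (Fin N) ℂ) : in1 A * in2 B = A ⊗ₖ B := by
  rw [in1, in2, ← Matrix.mul_kronecker_mul, mul_one, one_mul]

theorem in2_mul_in1 (A B : Matrix (Fin N) (Fin N) ℂ) : in2 B * in1 A = A ⊗ₖ B := by
  rw [in1, in2, ← Matrix.mul_kronecker_mul, mul_one, one_mul]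

/-- The part of `c {L^a_1(z), L^a_2(w)}` in which the positions at site `a` are differentiated as
the right-hand arguments of `L^a`. The momenta act by right multiplication with diagonal units. -/
def rightTerm (τ η c : ℂ) (a : ZMod n) (z w : ℂ) (x : Phase N n) : Mat2 N :=
  ∑ k, ((lax τ η c a z x * diagUnit k) ⊗ₖ laxDerivRight τ η c a w x k -
    laxDerivRight τ η c a z x k ⊗ₖ (lax τ η c a w x * diagUnit k))

/-- The contribution of the positions at site `a - 1` to the bracket, in which the momenta are those
of the neighbouring factor `L^{a-1}`, whence the diagonal units on the left. -/
def leftTerm (τ η c : ℂ) (a : ZMod n) (z w : ℂ) (x : Phase N n) : Mat2 N :=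
  ∑ k, ((diagUnit k * lax τ η c a z x) ⊗ₖ laxDerivLeft τ η c a w x k -
    laxDerivLeft τ η c a z x k ⊗ₖ (diagUnit k * lax τ η c a w x))

theorem rightTerm_apply (τ η c : ℂ) (a : ZMod n) (z w : ℂ) (x : Phase N n) (i k j l : Fin N) :
    rightTerm τ η c a z w x (i, k) (j, l) =
      lax τ η c a z x i j * laxDerivRight τ η c a w x j k l -
        laxDerivRight τ η c a z x l i j * lax τ η c a w x k l := by
  simp [rightTerm, Matrix.sum_apply, Matrix.kroneckerMap_apply, mul_diagUnit_apply]

theorem leftTerm_apply (τ η c : ℂ) (a : ZMod n) (z w : ℂ) (x : Phase N n) (i k j l : Fin N) :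
    leftTerm τ η c a z w x (i, k) (j, l) =
      lax τ η c a z x i j * laxDerivLeft τ η c a w x i k l -
        laxDerivLeft τ η c a z x k i j * lax τ η c a w x k l := by
  simp [leftTerm, Matrix.sum_apply, Matrix.kroneckerMap_apply, diagUnit_mul_apply]

/-- The local exchange relation. Entrywise, it is trivial when both pairs of indices coincide, is
`phiDeriv_mul_phi_sub` when one pair does, and `phi_mul_phi_mul_E1` otherwise. -/
theorem rightTerm_add_leftTerm {τ η c : ℂ} (hτ : 0 < τ.im) {a : ZMod n} {z w : ℂ} {x : Phase N n}
    (hz : theta τ z ≠ 0) (hw : theta τ w ≠ 0) (hzw : theta τ (z - w) ≠ 0)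
    (hq : ∀ (a : ZMod n) (i j : Fin N), i ≠ j → theta τ (x.1 a i - x.1 a j) ≠ 0)
    (hqη : ∀ i j : Fin N, theta τ (x.1 (a - 1) i - x.1 a j + η) ≠ 0) :
    rightTerm τ η c a z w x + leftTerm τ η c a z w x =
      (lax τ η c a z x ⊗ₖ lax τ η c a w x) * r12 τ a z w x -
        r12 τ (a - 1) z w x * (lax τ η c a z x ⊗ₖ lax τ η c a w x) := by
  ext ⟨i, k⟩ ⟨j, l⟩
  rw [Matrix.add_apply, Matrix.sub_apply, rightTerm_apply, leftTerm_apply, mul_r12_apply,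
    r12_mul_apply]
  simp only [Matrix.kroneckerMap_apply, laxDerivRight, laxDerivLeft, lax, Matrix.of_apply]
  by_cases hik : i = k <;> by_cases hjl : j = l
  · subst hik hjl
    simp only [if_true]
    ring
  · subst hik
    have h := phiDeriv_mul_phi_sub hτ (A := x.1 (a - 1) i - x.1 a j + η)
      (D := x.1 (a - 1) i - x.1 a l + η) hz hw hzw (hqη i j) (hqη i l)
      (by simpa using hq a l j (Ne.symm hjl))
    rw [show x.1 (a - 1) i - x.1 a j + η - (x.1 (a - 1) i - x.1 a l + η) = x.1 a l - x.1 a j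
      by ring] at h
    have h2 := E1_neg τ (x.1 a l - x.1 a j)
    rw [neg_sub] at h2
    simp only [if_true, hjl, Ne.symm hjl, if_false]
    rw [h2]
    linear_combination -(coeffB τ η c a x j * coeffB τ η c a x l) * h
  · subst hjl
    have h := phiDeriv_mul_phi_sub hτ (A := x.1 (a - 1) i - x.1 a j + η)
      (D := x.1 (a - 1) k - x.1 a j + η) hz hw hzw (hqη i j) (hqη k j)
      (by simpa using hq (a - 1) i k hik)
    rw [show x.1 (a - 1) i - x.1 a j + η - (x.1 (a - 1) k - x.1 a j + η) =
      x.1 (a - 1) i - x.1 (a - 1) k by ring] at h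
    simp only [if_true, hik, Ne.symm hik, if_false]
    linear_combination (coeffB τ η c a x j * coeffB τ η c a x j) * h
  · have h := phi_mul_phi_mul_E1 hτ (A := x.1 (a - 1) i - x.1 a j + η)
      (α := x.1 a l - x.1 a j) (β := x.1 (a - 1) i - x.1 (a - 1) k) hz hw hzw (hqη i j)
      (hq a l j (Ne.symm hjl)) (hq (a - 1) i k hik)
      (by convert hqη i l using 2; ring) (by convert hqη k j using 2; ring)
      (by convert hqη k l using 2; ring)
    rw [show x.1 (a - 1) i - x.1 a j + η - (x.1 a l - x.1 a j) -
        (x.1 (a - 1) i - x.1 (a - 1) k) = x.1 (a - 1) k - x.1 a l + η by ring,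
      show x.1 (a - 1) i - x.1 a j + η - (x.1 a l - x.1 a j) = x.1 (a - 1) i - x.1 a l + η by ring,
      show x.1 (a - 1) i - x.1 a j + η - (x.1 (a - 1) i - x.1 (a - 1) k) =
        x.1 (a - 1) k - x.1 a j + η by ring] at h
    have h2 := E1_neg τ (x.1 a l - x.1 a j)
    rw [neg_sub] at h2
    simp only [hik, hjl, Ne.symm hik, Ne.symm hjl, if_false]
    rw [h2]
    linear_combination (coeffB τ η c a x j * coeffB τ η c a x l) * h

/-! ### The derivatives at the site where the chain closes -/

theorem isUnit_det_in1 {A : Matrix (Fin N) (Fin N) ℂ} (h : IsUnit A.det) : IsUnit (in1 A).det := by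
  rw [in1, Matrix.det_kronecker, Matrix.det_one, one_pow, mul_one]
  exact h.pow _

theorem isUnit_det_in2 {A : Matrix (Fin N) (Fin N) ℂ} (h : IsUnit A.det) : IsUnit (in2 A).det := by
  rw [in2, Matrix.det_kronecker, Matrix.det_one, one_pow, one_mul]
  exact h.pow _

/-- Where `ϑ(z + q_i^{a-1} - q_j^a + η)` does not vanish, `phiDeriv` is a logarithmic derivative
times the Kronecker function. -/
theorem laxDerivLeft_eq_dEtaLax {τ η c : ℂ} {a : ZMod n} {z : ℂ} {x : Phase N n}
    (hqη : ∀ i j : Fin N, theta τ (x.1 (a - 1) i - x.1 a j + η) ≠ 0)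
    (hqz : ∀ i j : Fin N, theta τ (z + x.1 (a - 1) i - x.1 a j + η) ≠ 0) (k i j : Fin N) :
    laxDerivLeft τ η c a z x k i j = (if i = k then dEtaLax τ η c a z x i j else 0) +
      lax τ η c a z x i j * E1 τ (x.1 (a - 1) k - x.1 a j + η) := by
  have e : z + (x.1 (a - 1) i - x.1 a j + η) = z + x.1 (a - 1) i - x.1 a j + η := by ring
  rw [laxDerivLeft, Matrix.of_apply, dEtaLax, phiDeriv_eq_phi_mul (hqη i j) (by rw [e]; exact hqz i j),
    e]
  simp only [lax, Matrix.of_apply]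
  congr 2
  ring

/-- The matrix `s^+` collects the derivatives of `L^a(z)` in the positions at site `a - 1`. -/
theorem in1_lax_mul_sPlus {τ η c : ℂ} {a : ZMod n} {z : ℂ} {x : Phase N n}
    (hqη : ∀ i j : Fin N, theta τ (x.1 (a - 1) i - x.1 a j + η) ≠ 0)
    (hqz : ∀ i j : Fin N, theta τ (z + x.1 (a - 1) i - x.1 a j + η) ≠ 0)
    (hL : IsUnit (lax τ η c a z x).det) :
    in1 (lax τ η c a z x) * sPlus τ η c a z x =
      ∑ k, laxDerivLeft τ η c a z x k ⊗ₖ diagUnit k := by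
  rw [sPlus, s12, mul_add, Matrix.mul_nonsing_inv_cancel_left _ _ (isUnit_det_in1 hL)]
  ext ⟨i, k⟩ ⟨j, l⟩
  rw [Matrix.add_apply, sum_smul_EE_left_apply, Matrix.mul_apply, Fintype.sum_prod_type,
    Matrix.sum_apply]
  simp only [uPlus, sum_smul_EE_diag_apply, Matrix.kroneckerMap_apply, laxDerivLeft_eq_dEtaLax hqη hqz,
    in1, Matrix.one_apply, diagUnit, Matrix.single_apply]
  by_cases hkl : k = l
  · subst hkl
    rw [Finset.sum_eq_single j, Finset.sum_eq_single k, Finset.sum_eq_single k]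
    · simp
    all_goals first | (intro b _ hb; simp [hb, hb.symm]) | simp
  · rw [Finset.sum_eq_zero, Finset.sum_eq_zero]
    · simp [hkl]
    · intro b _
      have : ¬(b = k ∧ b = l) := fun h => hkl (h.1.symm.trans h.2)
      simp [this]
    · intro b _
      refine Finset.sum_eq_zero fun d _ => ?_
      by_cases h : k = d
      · subst h
        simp [hkl]
      · simp [h]

/-- The matrix `s^-` collects the derivatives of `L^a(w)` in the positions at site `a - 1`. -/
theorem in2_lax_mul_sMinus {τ η c : ℂ} {a : ZMod n} {w : ℂ} {x : Phase N n}
    (hqη : ∀ i j : Fin N, theta τ (x.1 (a - 1) i - x.1 a j + η) ≠ 0)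
    (hqw : ∀ i j : Fin N, theta τ (w + x.1 (a - 1) i - x.1 a j + η) ≠ 0)
    (hL : IsUnit (lax τ η c a w x).det) :
    in2 (lax τ η c a w x) * sMinus τ η c a w x =
      ∑ k, diagUnit k ⊗ₖ laxDerivLeft τ η c a w x k := by
  rw [sMinus, s21, mul_sub, Matrix.mul_nonsing_inv_cancel_left _ _ (isUnit_det_in2 hL)]
  ext ⟨i, k⟩ ⟨j, l⟩
  rw [Matrix.sub_apply, sum_smul_EE_right_apply, Matrix.mul_apply, Fintype.sum_prod_type,
    Matrix.sum_apply]
  simp only [uMinus, Matrix.neg_apply, sum_smul_EE_diag_apply, Matrix.kroneckerMap_apply,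
    laxDerivLeft_eq_dEtaLax hqη hqw, in2, Matrix.one_apply, diagUnit, Matrix.single_apply]
  by_cases hij : i = j
  · subst hij
    rw [Finset.sum_eq_single i, Finset.sum_eq_single l, Finset.sum_eq_single i]
    · simp [eq_comm]
    all_goals first | (intro b _ hb; simp [hb, hb.symm]) | simp
  · rw [Finset.sum_eq_zero, Finset.sum_eq_zero]
    · simp [hij]
    · intro b _
      have : ¬(b = i ∧ b = j) := fun h => hij (h.1.symm.trans h.2)
      simp [this]
    · intro b _
      refine Finset.sum_eq_zero fun d _ => ?_
      by_cases h : i = b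
      · subst h
        simp [hij]
      · simp [h]

end

section

variable {N n : ℕ}

/-! ### Derivatives of the Lax matrices -/

/-- The coordinate function `q_i^a`. -/
def posCoord (a : ZMod n) (i : Fin N) : Phase N n →L[ℂ] ℂ :=
  ((ContinuousLinearMap.proj i).comp (ContinuousLinearMap.proj a)).comp
    (ContinuousLinearMap.fst ℂ (ZMod n → Fin N → ℂ) (ZMod n → Fin N → ℂ))

/-- The coordinate function `p_i^a`. -/
def momCoord (a : ZMod n) (i : Fin N) : Phase N n →L[ℂ] ℂ :=
  ((ContinuousLinearMap.proj i).comp (ContinuousLinearMap.proj a)).comp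
    (ContinuousLinearMap.snd ℂ (ZMod n → Fin N → ℂ) (ZMod n → Fin N → ℂ))

/-- The tangent vector `∂ / ∂q_k^b`. -/
def posDir (b : ZMod n) (k : Fin N) : Phase N n := (Pi.single b (Pi.single k 1), 0)

/-- The tangent vector `∂ / ∂p_k^b`. -/
def momDir (b : ZMod n) (k : Fin N) : Phase N n := (0, Pi.single b (Pi.single k 1))

theorem single_single_apply (a b : ZMod n) (i k : Fin N) :
    (Pi.single b (Pi.single k 1) : ZMod n → Fin N → ℂ) a i =
      if a = b then (if i = k then 1 else 0) else 0 := by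
  by_cases h : a = b
  · subst h
    simp [Pi.single_apply]
  · simp [h]

theorem posCoord_posDir (a b : ZMod n) (i k : Fin N) :
    posCoord a i (posDir b k) = if a = b then (if i = k then 1 else 0) else 0 :=
  single_single_apply a b i k

theorem posCoord_momDir (a b : ZMod n) (i k : Fin N) : posCoord a i (momDir b k) = 0 := rfl

theorem momCoord_posDir (a b : ZMod n) (i k : Fin N) : momCoord a i (posDir b k) = 0 := rfl

theorem momCoord_momDir (a b : ZMod n) (i k : Fin N) :
    momCoord a i (momDir b k) = if a = b then (if i = k then 1 else 0) else 0 :=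
  single_single_apply a b i k

variable [NeZero n]

section LogDeriv

/-! Derivatives are recorded in the form `f x • e`, with `e` the differential of `log f` at `x`, so
that products only add up the `e`. -/

variable {E : Type*} [NormedAddCommGroup E] [NormedSpace ℂ E]

theorem hasFDerivAt_theta_comp {τ : ℂ} (hτ : 0 < τ.im) {g : E → ℂ} {g' : E →L[ℂ] ℂ} {x : E}
    (hg : HasFDerivAt g g' x) (h0 : theta τ (g x) ≠ 0) :
    HasFDerivAt (fun y => theta τ (g y)) (theta τ (g x) • (E1 τ (g x) • g')) x := by
  refine ((hasDerivAt_theta hτ (g x)).comp_hasFDerivAt x hg).congr_fderiv ?_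
  rw [smul_smul, E1, mul_div_cancel₀ _ h0]

theorem hasFDerivAt_prod_log {ι : Type*} [DecidableEq ι] (s : Finset ι) {g : ι → E → ℂ}
    {e : ι → E →L[ℂ] ℂ} {x : E} (hg : ∀ i ∈ s, HasFDerivAt (g i) (g i x • e i) x) :
    HasFDerivAt (fun y => ∏ i ∈ s, g i y) ((∏ i ∈ s, g i x) • ∑ i ∈ s, e i) x := by
  have h := HasFDerivAt.finsetProd hg
  refine (h.congr_fderiv ?_).congr_of_eventuallyEq (Filter.Eventually.of_forall fun y => ?_)
  · rw [Finset.smul_sum]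
    refine Finset.sum_congr rfl fun i hi => ?_
    rw [smul_smul, Finset.prod_erase_mul _ _ hi]
  · simp

theorem hasFDerivAt_mul_log {f g : E → ℂ} {d e : E →L[ℂ] ℂ} {x : E}
    (hf : HasFDerivAt f (f x • d) x) (hg : HasFDerivAt g (g x • e) x) :
    HasFDerivAt (fun y => f y * g y) ((f x * g x) • (d + e)) x := by
  refine (hf.mul hg).congr_fderiv ?_
  ext v
  simp only [add_apply, smul_apply, smul_eq_mul]
  ring

theorem hasFDerivAt_inv_log {f : E → ℂ} {d : E →L[ℂ] ℂ} {x : E}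
    (hf : HasFDerivAt f (f x • d) x) (h0 : f x ≠ 0) :
    HasFDerivAt (fun y => (f y)⁻¹) ((f x)⁻¹ • (-d)) x := by
  refine ((hasDerivAt_inv h0).comp_hasFDerivAt x hf).congr_fderiv ?_
  ext v
  simp only [neg_apply, smul_apply, smul_eq_mul]
  field_simp

end LogDeriv

/-- The differential of `log b_j^a`. -/
def dLogB (τ η c : ℂ) (a : ZMod n) (x : Phase N n) (j : Fin N) : Phase N n →L[ℂ] ℂ :=
  ∑ l, E1 τ (x.1 a j - x.1 (a - 1) l - η) • (posCoord a j - posCoord (a - 1) l) -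
    ∑ l ∈ Finset.univ.erase j, E1 τ (x.1 a j - x.1 a l) • (posCoord a j - posCoord a l) +
    c⁻¹ • momCoord a j

theorem hasFDerivAt_coeffB {τ η c : ℂ} (hτ : 0 < τ.im) (hη : theta τ η ≠ 0) {a : ZMod n}
    {x : Phase N n} (hq : ∀ i j : Fin N, i ≠ j → theta τ (x.1 a i - x.1 a j) ≠ 0)
    (hqη : ∀ i j : Fin N, theta τ (x.1 (a - 1) i - x.1 a j + η) ≠ 0) (j : Fin N) :
    HasFDerivAt (fun y => coeffB τ η c a y j) (coeffB τ η c a x j • dLogB τ η c a x j) x := by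
  have hpos : ∀ (b : ZMod n) (l : Fin N), HasFDerivAt (fun y : Phase N n => y.1 b l)
      (posCoord b l) x := fun b l => (posCoord b l).hasFDerivAt
  have hmom : HasFDerivAt (fun y : Phase N n => y.2 a j) (momCoord a j) x :=
    (momCoord a j).hasFDerivAt
  have hnum := hasFDerivAt_prod_log Finset.univ fun l _ =>
    hasFDerivAt_theta_comp hτ (((hpos a j).sub (hpos (a - 1) l)).sub_const η) (by
      intro h0
      refine hqη l j ?_
      rw [← neg_eq_zero, ← theta_neg]
      exact (congrArg (theta τ) (by simp only [Pi.sub_apply]; ring)).trans h0)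
  have hden := hasFDerivAt_prod_log (Finset.univ.erase j) fun l hl =>
    hasFDerivAt_theta_comp hτ ((hpos a j).sub (hpos a l))
      (hq j l (Finset.ne_of_mem_erase hl).symm)
  have hη' : theta τ (-η) ≠ 0 := by rwa [theta_neg, neg_ne_zero]
  have hconst : HasFDerivAt (fun _ : Phase N n => theta τ (-η))
      (theta τ (-η) • (0 : Phase N n →L[ℂ] ℂ)) x :=
    (hasFDerivAt_const _ _).congr_fderiv 
      (ContinuousLinearMap.ext fun _ => (mul_zero (theta τ (-η))).symm)
  have hinv := hasFDerivAt_inv_log (hasFDerivAt_mul_log hconst hden)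
    (mul_ne_zero hη' (Finset.prod_ne_zero_iff.2 fun l hl =>
      hq j l (Finset.ne_of_mem_erase hl).symm))
  have hexp := (hmom.mul_const c⁻¹).cexp
  refine (hasFDerivAt_mul_log (hasFDerivAt_mul_log hnum hinv) hexp).congr_fderiv ?_
  rw [dLogB, coeffB, zero_add, sub_eq_add_neg]
  rfl

theorem hasFDerivAt_lax {τ η c : ℂ} (hτ : 0 < τ.im) (hη : theta τ η ≠ 0) {a : ZMod n} {z : ℂ}
    {x : Phase N n} (hz : theta τ z ≠ 0)
    (hq : ∀ i j : Fin N, i ≠ j → theta τ (x.1 a i - x.1 a j) ≠ 0)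
    (hqη : ∀ i j : Fin N, theta τ (x.1 (a - 1) i - x.1 a j + η) ≠ 0) (i j : Fin N) :
    HasFDerivAt (fun y => lax τ η c a z y i j)
      ((phiDeriv τ z (x.1 (a - 1) i - x.1 a j + η) * coeffB τ η c a x j) •
        (posCoord (a - 1) i - posCoord a j) + lax τ η c a z x i j • dLogB τ η c a x j) x := by
  have hpos : ∀ (b : ZMod n) (l : Fin N), HasFDerivAt (fun y : Phase N n => y.1 b l)
      (posCoord b l) x := fun b l => (posCoord b l).hasFDerivAt
  have hphi := (hasDerivAt_phi hτ hz (hqη i j)).comp_hasFDerivAt x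
    (((hpos (a - 1) i).sub (hpos a j)).add_const η)
  refine (hphi.mul (hasFDerivAt_coeffB (c := c) hτ hη hq hqη j)).congr_fderiv ?_
  refine ContinuousLinearMap.ext fun v => ?_
  simp only [lax, Matrix.of_apply, add_apply, smul_apply,
    smul_eq_mul, Function.comp_apply, Pi.sub_apply]
  ring

/-- For `n = 1` both conditions hold when `b = a`, and the two parts add up. -/
theorem fderiv_lax_posDir {τ η c : ℂ} (hτ : 0 < τ.im) (hη : theta τ η ≠ 0) {a : ZMod n} {z : ℂ}
    {x : Phase N n} (hz : theta τ z ≠ 0)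
    (hq : ∀ i j : Fin N, i ≠ j → theta τ (x.1 a i - x.1 a j) ≠ 0)
    (hqη : ∀ i j : Fin N, theta τ (x.1 (a - 1) i - x.1 a j + η) ≠ 0)
    (b : ZMod n) (k i j : Fin N) :
    fderiv ℂ (fun y => lax τ η c a z y i j) x (posDir b k) =
      (if a = b then laxDerivRight τ η c a z x k i j else 0) +
        (if a - 1 = b then laxDerivLeft τ η c a z x k i j else 0) := by
  rw [(hasFDerivAt_lax hτ hη hz hq hqη i j).fderiv]
  have hE : E1 τ (x.1 a j - x.1 (a - 1) k - η) = -E1 τ (x.1 (a - 1) k - x.1 a j + η) := by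
    rw [← E1_neg]
    congr 1
    ring
  have hk : ∑ l ∈ Finset.univ.erase j,
      E1 τ (x.1 a j - x.1 a l) * (if a = b then (if l = k then 1 else 0) else 0) =
      if a = b then (if j = k then 0 else E1 τ (x.1 a j - x.1 a k)) else 0 := by
    by_cases hab : a = b
    · by_cases h : j = k
      · simp [h]
      · simp [hab, h, Ne.symm h]
    · simp [hab]
  have hl : ∑ l, E1 τ (x.1 a j - x.1 (a - 1) l - η) *
      (if a - 1 = b then (if l = k then 1 else 0) else 0) =
      if a - 1 = b then -E1 τ (x.1 (a - 1) k - x.1 a j + η) else 0 := by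
    rw [← hE]
    by_cases hab : a - 1 = b <;> simp [hab]
  simp only [dLogB, add_apply, sub_apply, smul_apply, sum_apply, smul_eq_mul, posCoord_posDir,
    momCoord_posDir, laxDerivRight, laxDerivLeft, Matrix.of_apply, mul_sub, Finset.sum_sub_distrib,
    ← Finset.sum_mul, hk, hl, logDerivB]
  split_ifs <;> ring

theorem fderiv_lax_momDir {τ η c : ℂ} (hτ : 0 < τ.im) (hη : theta τ η ≠ 0) {a : ZMod n} {z : ℂ}
    {x : Phase N n} (hz : theta τ z ≠ 0)
    (hq : ∀ i j : Fin N, i ≠ j → theta τ (x.1 a i - x.1 a j) ≠ 0)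
    (hqη : ∀ i j : Fin N, theta τ (x.1 (a - 1) i - x.1 a j + η) ≠ 0)
    (b : ZMod n) (k i j : Fin N) :
    fderiv ℂ (fun y => lax τ η c a z y i j) x (momDir b k) =
      if a = b then c⁻¹ * (lax τ η c a z x * diagUnit k) i j else 0 := by
  rw [(hasFDerivAt_lax hτ hη hz hq hqη i j).fderiv]
  simp only [dLogB, add_apply, sub_apply,
    smul_apply, sum_apply, smul_eq_mul, posCoord_momDir,
    momCoord_momDir, mul_diagUnit_apply]
  by_cases hab : a = b <;> by_cases hj : j = k <;> simp [hab, hj, mul_comm]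

end

section

/-! ### Ordered products of matrices and their derivatives -/

section Segment

variable {R : Type*} [Monoid R]

/-- The ordered product `A s * A (s + 1) * ⋯ * A (t - 1)`. -/
def segProd (A : ℕ → R) (s t : ℕ) : R := ((List.range' s (t - s)).map A).prod

theorem segProd_self (A : ℕ → R) (s : ℕ) : segProd A s s = 1 := by
  simp [segProd]

theorem segProd_succ_right (A : ℕ → R) {s t : ℕ} (h : s ≤ t) :
    segProd A s (t + 1) = segProd A s t * A t := by
  rw [segProd, segProd, Nat.succ_sub h, List.range'_concat, List.map_append, List.prod_append]
  simp [Nat.add_sub_cancel' h]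

theorem segProd_succ_left (A : ℕ → R) {s t : ℕ} (h : s < t) :
    segProd A s t = A s * segProd A (s + 1) t := by
  obtain ⟨d, rfl⟩ : ∃ d, t = s + 1 + d := ⟨t - (s + 1), by omega⟩
  rw [segProd, segProd, show s + 1 + d - s = d + 1 by omega, show s + 1 + d - (s + 1) = d by omega,
    List.range'_succ, List.map_cons, List.prod_cons]

theorem prod_ofFn_eq_segProd (A : ℕ → R) (t : ℕ) :
    (List.ofFn fun k : Fin t => A k).prod = segProd A 0 t := by
  rw [segProd]
  congr 1
  refine List.ext_getElem (by simp) fun i _ _ => by simp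

end Segment

section Leibniz

variable {N : ℕ} {E : Type*} [NormedAddCommGroup E] [NormedSpace ℂ E]

/-- The entrywise directional derivative of a matrix-valued function; no norm on matrices is
involved. -/
def matDeriv (A : E → Matrix (Fin N) (Fin N) ℂ) (x v : E) : Matrix (Fin N) (Fin N) ℂ :=
  Matrix.of fun i j => fderiv ℂ (fun y => A y i j) x v

/-- Entrywise differentiability of a matrix-valued function. -/
def MatDiffAt (A : E → Matrix (Fin N) (Fin N) ℂ) (x : E) : Prop :=
  ∀ i j, DifferentiableAt ℂ (fun y => A y i j) x

theorem MatDiffAt.mul {A B : E → Matrix (Fin N) (Fin N) ℂ} {x : E} (hA : MatDiffAt A x)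
    (hB : MatDiffAt B x) : MatDiffAt (fun y => A y * B y) x := by
  intro i j
  simp only [Matrix.mul_apply]
  exact DifferentiableAt.fun_sum fun k _ => (hA i k).mul (hB k j)

theorem matDeriv_mul {A B : E → Matrix (Fin N) (Fin N) ℂ} {x : E} (hA : MatDiffAt A x)
    (hB : MatDiffAt B x) (v : E) :
    matDeriv (fun y => A y * B y) x v = matDeriv A x v * B x + A x * matDeriv B x v := by
  ext i j
  have h : HasFDerivAt (fun y => (A y * B y) i j)
      (∑ k, (A x i k • fderiv ℂ (fun y => B y k j) x + B x k j • fderiv ℂ (fun y => A y i k) x)) x := by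
    simp only [Matrix.mul_apply]
    exact HasFDerivAt.fun_sum fun k _ => (hA i k).hasFDerivAt.mul (hB k j).hasFDerivAt
  rw [matDeriv, Matrix.of_apply, h.fderiv]
  simp only [matDeriv, Matrix.of_apply, sum_apply, add_apply, smul_apply, smul_eq_mul,
    Matrix.add_apply, Matrix.mul_apply, ← Finset.sum_add_distrib]
  exact Finset.sum_congr rfl fun k _ => by ring

theorem MatDiffAt.segProd {A : ℕ → E → Matrix (Fin N) (Fin N) ℂ} {x : E}
    (hA : ∀ m, MatDiffAt (A m) x) (t : ℕ) :
    MatDiffAt (fun y => segProd (fun m => A m y) 0 t) x := by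
  induction t with
  | zero =>
    simp only [segProd_self]
    exact fun i j => differentiableAt_const _
  | succ t ih =>
    simp only [segProd_succ_right _ (Nat.zero_le t)]
    exact ih.mul (hA t)

theorem matDeriv_segProd {A : ℕ → E → Matrix (Fin N) (Fin N) ℂ} {x : E}
    (hA : ∀ m, MatDiffAt (A m) x) (v : E) (t : ℕ) :
    matDeriv (fun y => segProd (fun m => A m y) 0 t) x v =
      ∑ m ∈ Finset.range t, segProd (fun m => A m x) 0 m * matDeriv (A m) x v *
        segProd (fun m => A m x) (m + 1) t := by
  induction t with
  | zero =>
    ext i j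
    simp [segProd_self, matDeriv]
  | succ t ih =>
    simp only [segProd_succ_right _ (Nat.zero_le t)]
    rw [matDeriv_mul (MatDiffAt.segProd hA t) (hA t), ih, Finset.sum_range_succ, segProd_self,
      mul_one, Finset.sum_mul]
    congr 1
    refine Finset.sum_congr rfl fun m hm => ?_
    rw [segProd_succ_right _ (Nat.succ_le_of_lt (Finset.mem_range.1 hm)), mul_assoc _ _ (A t x)]

end Leibniz

/-! ### The bracket of two monodromy matrices -/

variable {N n : ℕ}

theorem monodromy_eq_segProd (τ η c z : ℂ) (x : Phase N n) :
    monodromy τ η c z x = segProd (fun m : ℕ => lax τ η c ((m : ZMod n) + 1) z x) 0 n :=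
  prod_ofFn_eq_segProd (fun m : ℕ => lax τ η c ((m : ZMod n) + 1) z x) n

theorem natCast_inj_of_lt {m m' : ℕ} (hm : m < n) (hm' : m' < n) :
    (m : ZMod n) = m' ↔ m = m' := by
  rw [ZMod.natCast_eq_natCast_iff]
  exact ⟨fun h => Nat.ModEq.eq_of_lt_of_lt h hm hm', fun h => h ▸ Nat.ModEq.refl _⟩

/-- The product `L^1(z) ⋯ L^m(z)`. -/
def laxPrefix (τ η c z : ℂ) (x : Phase N n) (m : ℕ) : Matrix (Fin N) (Fin N) ℂ :=
  segProd (fun m : ℕ => lax τ η c ((m : ZMod n) + 1) z x) 0 m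

/-- The product `L^{m+1}(z) ⋯ L^n(z)`. -/
def laxSuffix (τ η c z : ℂ) (x : Phase N n) (m : ℕ) : Matrix (Fin N) (Fin N) ℂ :=
  segProd (fun m : ℕ => lax τ η c ((m : ZMod n) + 1) z x) m n

theorem laxPrefix_succ (τ η c z : ℂ) (x : Phase N n) (m : ℕ) :
    laxPrefix τ η c z x (m + 1) = laxPrefix τ η c z x m * lax τ η c ((m : ZMod n) + 1) z x :=
  segProd_succ_right _ (Nat.zero_le m)

theorem laxSuffix_eq_mul (τ η c z : ℂ) (x : Phase N n) {m : ℕ} (hm : m < n) :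
    laxSuffix τ η c z x m = lax τ η c ((m : ZMod n) + 1) z x * laxSuffix τ η c z x (m + 1) :=
  segProd_succ_left _ hm

theorem laxPrefix_zero (τ η c z : ℂ) (x : Phase N n) : laxPrefix τ η c z x 0 = 1 :=
  segProd_self _ _

theorem laxSuffix_self (τ η c z : ℂ) (x : Phase N n) : laxSuffix τ η c z x n = 1 :=
  segProd_self _ _

theorem laxPrefix_self (τ η c z : ℂ) (x : Phase N n) :
    laxPrefix τ η c z x n = monodromy τ η c z x :=
  (monodromy_eq_segProd τ η c z x).symm

theorem laxSuffix_zero (τ η c z : ℂ) (x : Phase N n) :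
    laxSuffix τ η c z x 0 = monodromy τ η c z x :=
  (monodromy_eq_segProd τ η c z x).symm

variable [NeZero n]

theorem bracket12_eq_sum (A B : Phase N n → Matrix (Fin N) (Fin N) ℂ) (x : Phase N n) :
    bracket12 A B x = ∑ a : ZMod n, ∑ k : Fin N,
      (matDeriv A x (momDir a k) ⊗ₖ matDeriv B x (posDir a k) -
        matDeriv A x (posDir a k) ⊗ₖ matDeriv B x (momDir a k)) := by
  ext ⟨i, k⟩ ⟨j, l⟩
  rw [bracket12, sum_smul_EE_apply, poisson]
  simp only [Matrix.sum_apply, Matrix.sub_apply]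
  rfl

theorem sum_zmod_eq_sum_range {M : Type*} [AddCommMonoid M] (f : ZMod n → M) :
    ∑ a, f a = ∑ m ∈ Finset.range n, f ((m : ZMod n) + 1) := by
  rw [← Equiv.sum_comp (Equiv.addRight (1 : ZMod n)) f]
  symm
  refine Finset.sum_nbij (fun m : ℕ => (m : ZMod n)) (fun _ _ => Finset.mem_univ _) ?_ ?_
    fun _ _ => rfl
  · intro m hm m' hm' h
    exact (natCast_inj_of_lt (Finset.mem_range.1 hm) (Finset.mem_range.1 hm')).1 h
  · intro a _
    exact ⟨a.val, Finset.mem_coe.2 (Finset.mem_range.2 (ZMod.val_lt a)), ZMod.natCast_zmod_val a⟩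

theorem matDiffAt_lax {τ η c : ℂ} (hτ : 0 < τ.im) (hη : theta τ η ≠ 0) {z : ℂ}
    {x : Phase N n} (hz : theta τ z ≠ 0)
    (hq : ∀ (a : ZMod n) (i j : Fin N), i ≠ j → theta τ (x.1 a i - x.1 a j) ≠ 0)
    (hqη : ∀ (a : ZMod n) (i j : Fin N), theta τ (x.1 (a - 1) i - x.1 a j + η) ≠ 0) (a : ZMod n) :
    MatDiffAt (lax τ η c a z) x :=
  fun i j => (hasFDerivAt_lax hτ hη hz (hq a) (hqη a) i j).differentiableAt

section Derivatives

variable {τ η c : ℂ} (hτ : 0 < τ.im) (hη : theta τ η ≠ 0) {z : ℂ} {x : Phase N n}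
  (hz : theta τ z ≠ 0)
  (hq : ∀ (a : ZMod n) (i j : Fin N), i ≠ j → theta τ (x.1 a i - x.1 a j) ≠ 0)
  (hqη : ∀ (a : ZMod n) (i j : Fin N), theta τ (x.1 (a - 1) i - x.1 a j + η) ≠ 0)

include hτ hη hz hq hqη

theorem matDiffAt_monodromy : MatDiffAt (monodromy τ η c z) x := by
  have h := MatDiffAt.segProd (A := fun m : ℕ => lax τ η c ((m : ZMod n) + 1) z)
    (fun m => matDiffAt_lax (c := c) hτ hη hz hq hqη ((m : ZMod n) + 1)) n
  simp only [← monodromy_eq_segProd] at h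
  exact h

theorem matDeriv_monodromy (v : Phase N n) :
    matDeriv (monodromy τ η c z) x v = ∑ m ∈ Finset.range n,
      laxPrefix τ η c z x m * matDeriv (lax τ η c ((m : ZMod n) + 1) z) x v *
        laxSuffix τ η c z x (m + 1) := by
  have h := matDeriv_segProd (A := fun m : ℕ => lax τ η c ((m : ZMod n) + 1) z)
    (fun m => matDiffAt_lax (c := c) hτ hη hz hq hqη ((m : ZMod n) + 1)) v n
  simp only [← monodromy_eq_segProd] at h
  exact h

theorem matDeriv_lax_posDir (a b : ZMod n) (k : Fin N) :
    matDeriv (lax τ η c a z) x (posDir b k) =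
      (if a = b then laxDerivRight τ η c a z x k else 0) +
        (if a - 1 = b then laxDerivLeft τ η c a z x k else 0) := by
  ext i j
  rw [matDeriv, Matrix.of_apply, fderiv_lax_posDir hτ hη hz (hq a) (hqη a)]
  split_ifs <;> rfl

theorem matDeriv_lax_momDir (a b : ZMod n) (k : Fin N) :
    matDeriv (lax τ η c a z) x (momDir b k) =
      if a = b then c⁻¹ • (lax τ η c a z x * diagUnit k) else 0 := by
  ext i j
  rw [matDeriv, Matrix.of_apply, fderiv_lax_momDir hτ hη hz (hq a) (hqη a)]
  split_ifs <;> rfl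

/-- Only the factor at the site itself depends on the momenta of that site. -/
theorem matDeriv_monodromy_momDir {m : ℕ} (hm : m < n) (k : Fin N) :
    matDeriv (monodromy τ η c z) x (momDir ((m : ZMod n) + 1) k) =
      c⁻¹ • (laxPrefix τ η c z x (m + 1) * diagUnit k * laxSuffix τ η c z x (m + 1)) := by
  rw [matDeriv_monodromy hτ hη hz hq hqη, Finset.sum_eq_single m]
  · rw [matDeriv_lax_momDir hτ hη hz hq hqη, if_pos rfl, laxPrefix_succ]
    simp only [Matrix.mul_smul, Matrix.smul_mul, mul_assoc]
  · intro m' hm' hne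
    rw [matDeriv_lax_momDir hτ hη hz hq hqη, if_neg, mul_zero, zero_mul]
    rwa [add_left_inj, natCast_inj_of_lt (Finset.mem_range.1 hm') hm]
  · exact fun h => absurd (Finset.mem_range.2 hm) h

/-- The positions at a site enter the factor at that site and the cyclically next one. The formula
is also right for `n = 1`, where these two factors are the same. -/
theorem matDeriv_monodromy_posDir {m m' : ℕ} (hm : m < n) (hm' : m' < n)
    (hmm' : (m' : ZMod n) = (m : ZMod n) + 1) (k : Fin N) :
    matDeriv (monodromy τ η c z) x (posDir ((m : ZMod n) + 1) k) =
      laxPrefix τ η c z x m * laxDerivRight τ η c ((m : ZMod n) + 1) z x k *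
        laxSuffix τ η c z x (m + 1) +
      laxPrefix τ η c z x m' * laxDerivLeft τ η c ((m' : ZMod n) + 1) z x k *
        laxSuffix τ η c z x (m' + 1) := by
  rw [matDeriv_monodromy hτ hη hz hq hqη]
  simp only [matDeriv_lax_posDir hτ hη hz hq hqη, mul_add, add_mul, Finset.sum_add_distrib]
  congr 1
  · rw [Finset.sum_eq_single m]
    · rw [if_pos rfl]
    · intro l hl hne
      rw [if_neg, mul_zero, zero_mul]
      rwa [add_left_inj, natCast_inj_of_lt (Finset.mem_range.1 hl) hm]
    · exact fun h => absurd (Finset.mem_range.2 hm) h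
  · rw [Finset.sum_eq_single m']
    · rw [if_pos (by rw [add_sub_cancel_right, hmm'])]
    · intro l hl hne
      rw [if_neg, mul_zero, zero_mul]
      rwa [add_sub_cancel_right, ← hmm', natCast_inj_of_lt (Finset.mem_range.1 hl) hm']
    · exact fun h => absurd (Finset.mem_range.2 hm') h

end Derivatives

end

variable {N n : ℕ}

/-! ### Summation along the chain -/

/-- The terms in which a momentum and its position are taken in the same factor make up a
`rightTerm` dressed by the remaining factors. -/
theorem sum_right_eq (τ η c z w : ℂ) (x : Phase N n) (m : ℕ) :
    ∑ k, ((laxPrefix τ η c z x (m + 1) * diagUnit k * laxSuffix τ η c z x (m + 1)) ⊗ₖ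
        (laxPrefix τ η c w x m * laxDerivRight τ η c ((m : ZMod n) + 1) w x k *
          laxSuffix τ η c w x (m + 1)) -
      (laxPrefix τ η c z x m * laxDerivRight τ η c ((m : ZMod n) + 1) z x k *
          laxSuffix τ η c z x (m + 1)) ⊗ₖ
        (laxPrefix τ η c w x (m + 1) * diagUnit k * laxSuffix τ η c w x (m + 1))) =
      (laxPrefix τ η c z x m ⊗ₖ laxPrefix τ η c w x m) *
        rightTerm τ η c ((m : ZMod n) + 1) z w x *
        (laxSuffix τ η c z x (m + 1) ⊗ₖ laxSuffix τ η c w x (m + 1)) := by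
  simp only [rightTerm, Matrix.mul_sum, Matrix.sum_mul, mul_sub, sub_mul,
    ← Matrix.mul_kronecker_mul, laxPrefix_succ, mul_assoc]

/-- The terms in which a momentum and its position are taken in two adjacent factors make up a
`leftTerm` dressed by the remaining factors. -/
theorem sum_left_eq (τ η c z w : ℂ) (x : Phase N n) {m : ℕ} (hm : m < n) :
    ∑ k, ((laxPrefix τ η c z x m * diagUnit k * laxSuffix τ η c z x m) ⊗ₖ
        (laxPrefix τ η c w x m * laxDerivLeft τ η c ((m : ZMod n) + 1) w x k *
          laxSuffix τ η c w x (m + 1)) -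
      (laxPrefix τ η c z x m * laxDerivLeft τ η c ((m : ZMod n) + 1) z x k *
          laxSuffix τ η c z x (m + 1)) ⊗ₖ
        (laxPrefix τ η c w x m * diagUnit k * laxSuffix τ η c w x m)) =
      (laxPrefix τ η c z x m ⊗ₖ laxPrefix τ η c w x m) *
        leftTerm τ η c ((m : ZMod n) + 1) z w x *
        (laxSuffix τ η c z x (m + 1) ⊗ₖ laxSuffix τ η c w x (m + 1)) := by
  simp only [leftTerm, Matrix.mul_sum, Matrix.sum_mul, mul_sub, sub_mul,
    ← Matrix.mul_kronecker_mul, laxSuffix_eq_mul _ _ _ _ _ hm, mul_assoc]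

/-- The contribution of the positions at site `n` through the first factor `L^1`, which is not
adjacent to the factor `L^n` carrying the conjugate momenta. -/
def closingTerm (τ η c z w : ℂ) (x : Phase N n) : Mat2 N :=
  ∑ k, ((monodromy τ η c z x * diagUnit k) ⊗ₖ
      (laxDerivLeft τ η c 1 w x k * laxSuffix τ η c w x 1) -
    (laxDerivLeft τ η c 1 z x k * laxSuffix τ η c z x 1) ⊗ₖ (monodromy τ η c w x * diagUnit k))

section Bracket

variable [NeZero n] {τ η c : ℂ} (hτ : 0 < τ.im) (hc : c ≠ 0) (hη : theta τ η ≠ 0) {z w : ℂ}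
  {x : Phase N n} (hz : theta τ z ≠ 0) (hw : theta τ w ≠ 0)
  (hq : ∀ (a : ZMod n) (i j : Fin N), i ≠ j → theta τ (x.1 a i - x.1 a j) ≠ 0)
  (hqη : ∀ (a : ZMod n) (i j : Fin N), theta τ (x.1 (a - 1) i - x.1 a j + η) ≠ 0)

include hτ hη hz hw hq hqη

include hc in
/-- The terms of the bracket that come from the site of the `m`-th factor. -/
theorem site_terms {m m' : ℕ} (hm : m < n) (hm' : m' < n)
    (hmm' : (m' : ZMod n) = (m : ZMod n) + 1) :
    c • ∑ k : Fin N,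
      (matDeriv (monodromy τ η c z) x (momDir ((m : ZMod n) + 1) k) ⊗ₖ
          matDeriv (monodromy τ η c w) x (posDir ((m : ZMod n) + 1) k) -
        matDeriv (monodromy τ η c z) x (posDir ((m : ZMod n) + 1) k) ⊗ₖ
          matDeriv (monodromy τ η c w) x (momDir ((m : ZMod n) + 1) k)) =
    (laxPrefix τ η c z x m ⊗ₖ laxPrefix τ η c w x m) *
        rightTerm τ η c ((m : ZMod n) + 1) z w x *
        (laxSuffix τ η c z x (m + 1) ⊗ₖ laxSuffix τ η c w x (m + 1)) +
      ∑ k, ((laxPrefix τ η c z x (m + 1) * diagUnit k * laxSuffix τ η c z x (m + 1)) ⊗ₖ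
          (laxPrefix τ η c w x m' * laxDerivLeft τ η c ((m' : ZMod n) + 1) w x k *
            laxSuffix τ η c w x (m' + 1)) -
        (laxPrefix τ η c z x m' * laxDerivLeft τ η c ((m' : ZMod n) + 1) z x k *
            laxSuffix τ η c z x (m' + 1)) ⊗ₖ
          (laxPrefix τ η c w x (m + 1) * diagUnit k * laxSuffix τ η c w x (m + 1))) := by
  rw [← sum_right_eq, Finset.smul_sum, ← Finset.sum_add_distrib]
  refine Finset.sum_congr rfl fun k _ => ?_
  rw [matDeriv_monodromy_momDir hτ hη hz hq hqη hm, matDeriv_monodromy_momDir hτ hη hw hq hqη hm,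
    matDeriv_monodromy_posDir hτ hη hz hq hqη hm hm' hmm',
    matDeriv_monodromy_posDir hτ hη hw hq hqη hm hm' hmm', Matrix.smul_kronecker,
    Matrix.kronecker_smul, ← smul_sub, smul_smul, mul_inv_cancel₀ hc, one_smul,
    Matrix.kronecker_add, Matrix.add_kronecker]
  abel

include hc in
/-- The bracket as a sum over the factors. The sum contains a `leftTerm` for every factor, also for
`L^1`, which has no predecessor in the product; it is taken off again and replaced by
`closingTerm`. -/
theorem smul_bracket12_eq :
    c • bracket12 (monodromy τ η c z) (monodromy τ η c w) x =
      ∑ m ∈ Finset.range n, (laxPrefix τ η c z x m ⊗ₖ laxPrefix τ η c w x m) *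
        (rightTerm τ η c ((m : ZMod n) + 1) z w x + leftTerm τ η c ((m : ZMod n) + 1) z w x) *
        (laxSuffix τ η c z x (m + 1) ⊗ₖ laxSuffix τ η c w x (m + 1)) -
      leftTerm τ η c 1 z w x * (laxSuffix τ η c z x 1 ⊗ₖ laxSuffix τ η c w x 1) +
      closingTerm τ η c z w x := by
  obtain ⟨d, hd⟩ : ∃ d, n = d + 1 := Nat.exists_eq_succ_of_ne_zero (NeZero.ne n)
  have hlast := site_terms hτ hc hη hz hw hq hqη (m := d) (m' := 0) (by omega) (by omega) (by
    have h := congrArg (Nat.cast (R := ZMod n)) hd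
    rw [ZMod.natCast_self] at h
    exact_mod_cast h)
  have hinner : ∀ m ∈ Finset.range d, _ := fun m hm =>
    site_terms hτ hc hη hz hw hq hqη (m := m) (m' := m + 1)
      (by have := Finset.mem_range.1 hm; omega) (by have := Finset.mem_range.1 hm; omega)
      (by push_cast; rfl)
  have hclose : closingTerm τ η c z w x =
      ∑ k, ((laxPrefix τ η c z x (d + 1) * diagUnit k * laxSuffix τ η c z x (d + 1)) ⊗ₖ
          (laxPrefix τ η c w x 0 * laxDerivLeft τ η c (((0 : ℕ) : ZMod n) + 1) w x k *
            laxSuffix τ η c w x (0 + 1)) -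
        (laxPrefix τ η c z x 0 * laxDerivLeft τ η c (((0 : ℕ) : ZMod n) + 1) z x k *
            laxSuffix τ η c z x (0 + 1)) ⊗ₖ
          (laxPrefix τ η c w x (d + 1) * diagUnit k * laxSuffix τ η c w x (d + 1))) := by
    simp only [← hd, laxPrefix_zero, laxSuffix_self, laxPrefix_self, one_mul, mul_one, zero_add,
      Nat.cast_zero, closingTerm]
  have hfirst : leftTerm τ η c 1 z w x * (laxSuffix τ η c z x 1 ⊗ₖ laxSuffix τ η c w x 1) =
      (laxPrefix τ η c z x 0 ⊗ₖ laxPrefix τ η c w x 0) *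
        leftTerm τ η c (((0 : ℕ) : ZMod n) + 1) z w x *
        (laxSuffix τ η c z x (0 + 1) ⊗ₖ laxSuffix τ η c w x (0 + 1)) := by
    simp only [laxPrefix_zero, Matrix.one_kronecker_one, one_mul, Nat.cast_zero, zero_add]
  rw [bracket12_eq_sum, sum_zmod_eq_sum_range, Finset.smul_sum]
  simp only [mul_add, add_mul, Finset.sum_add_distrib]
  -- Split off the last site on the left, and the first `leftTerm` on the right.
  rw [show Finset.range n = Finset.range (d + 1) by rw [hd], Finset.sum_range_succ, hlast,
    ← hclose, Finset.sum_congr rfl hinner, Finset.sum_add_distrib]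
  rw [Finset.sum_range_succ, Finset.sum_range_succ' (fun m => _ * leftTerm _ _ _ _ _ _ _ * _),
    ← hfirst]
  rw [Finset.sum_congr rfl fun m hm => sum_left_eq τ η c z w x (m := m + 1)
    (by have := Finset.mem_range.1 hm; omega)]
  abel

end Bracket

/-- By the local exchange relation the dressed `r`-matrices telescope along the chain. -/
theorem sum_local_eq {τ η c : ℂ} (hτ : 0 < τ.im) {z w : ℂ} {x : Phase N n}
    (hz : theta τ z ≠ 0) (hw : theta τ w ≠ 0) (hzw : theta τ (z - w) ≠ 0)
    (hq : ∀ (a : ZMod n) (i j : Fin N), i ≠ j → theta τ (x.1 a i - x.1 a j) ≠ 0)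
    (hqη : ∀ (a : ZMod n) (i j : Fin N), theta τ (x.1 (a - 1) i - x.1 a j + η) ≠ 0) :
    ∑ m ∈ Finset.range n, (laxPrefix τ η c z x m ⊗ₖ laxPrefix τ η c w x m) *
        (rightTerm τ η c ((m : ZMod n) + 1) z w x + leftTerm τ η c ((m : ZMod n) + 1) z w x) *
        (laxSuffix τ η c z x (m + 1) ⊗ₖ laxSuffix τ η c w x (m + 1)) =
      (monodromy τ η c z x ⊗ₖ monodromy τ η c w x) * r12 τ (n : ZMod n) z w x -
        r12 τ (n : ZMod n) z w x * (monodromy τ η c z x ⊗ₖ monodromy τ η c w x) := by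
  have h := Finset.sum_range_sub (fun m : ℕ => (laxPrefix τ η c z x m ⊗ₖ laxPrefix τ η c w x m) *
    r12 τ (m : ZMod n) z w x * (laxSuffix τ η c z x m ⊗ₖ laxSuffix τ η c w x m)) n
  simp only [laxPrefix_zero, laxSuffix_self, laxPrefix_self, laxSuffix_zero,
    Matrix.one_kronecker_one, one_mul, mul_one] at h
  rw [Nat.cast_zero, ← ZMod.natCast_self n] at h
  rw [← h]
  refine Finset.sum_congr rfl fun m hm => ?_
  rw [rightTerm_add_leftTerm hτ hz hw hzw hq (hqη _), add_sub_cancel_right, laxPrefix_succ,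
    laxPrefix_succ, laxSuffix_eq_mul _ _ _ _ _ (Finset.mem_range.1 hm),
    laxSuffix_eq_mul _ _ _ _ _ (Finset.mem_range.1 hm), Matrix.mul_kronecker_mul,
    Matrix.mul_kronecker_mul, Nat.cast_succ]
  noncomm_ring

end RuijsenaarsChain

end

open RuijsenaarsChain
theorem theorem2 (N n : ℕ) [NeZero n] (τ η c : ℂ) (hτ : 0 < τ.im) (hc : c ≠ 0)
    (hη : theta τ η ≠ 0) (x : Phase N n) (z w : ℂ)
    (hz : theta τ z ≠ 0) (hw : theta τ w ≠ 0) (hzw : theta τ (z - w) ≠ 0)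
    (hq : ∀ (a : ZMod n) (i j : Fin N), i ≠ j → theta τ (x.1 a i - x.1 a j) ≠ 0)
    (hqη : ∀ (a : ZMod n) (i j : Fin N), theta τ (x.1 (a - 1) i - x.1 a j + η) ≠ 0)
    (hqz : ∀ i j : Fin N, theta τ (z + x.1 0 i - x.1 1 j + η) ≠ 0)
    (hqw : ∀ i j : Fin N, theta τ (w + x.1 0 i - x.1 1 j + η) ≠ 0)
    (hLz : IsUnit (lax τ η c 1 z x).det) (hLw : IsUnit (lax τ η c 1 w x).det) :
    (∀ i j : Fin N, DifferentiableAt ℂ (fun y : Phase N n => monodromy τ η c z y i j) x ∧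
      DifferentiableAt ℂ (fun y : Phase N n => monodromy τ η c w y i j) x) ∧
    c • bracket12 (monodromy τ η c z) (monodromy τ η c w) x =
      in1 (monodromy τ η c z x) * in2 (monodromy τ η c w x) * r12 τ (n : ZMod n) z w x -
      (r12 τ (n : ZMod n) z w x - sBrevePlus τ η c z x + sBreveMinus τ η c w x) *
        in1 (monodromy τ η c z x) * in2 (monodromy τ η c w x) +
      in1 (monodromy τ η c z x) * sBreveMinus τ η c w x * in2 (monodromy τ η c w x) -
      in2 (monodromy τ η c w x) * sBrevePlus τ η c z x * in1 (monodromy τ η c z x) := by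
  refine ⟨fun i j => ⟨matDiffAt_monodromy hτ hη hz hq hqη i j,
    matDiffAt_monodromy hτ hη hw hq hqη i j⟩, ?_⟩
  rw [smul_bracket12_eq hτ hc hη hz hw hq hqη, sum_local_eq hτ hz hw hzw hq hqη]
  have hqz' : ∀ i j : Fin N, theta τ (z + x.1 (1 - 1) i - x.1 1 j + η) ≠ 0 := by
    simpa only [sub_self] using hqz
  have hqw' : ∀ i j : Fin N, theta τ (w + x.1 (1 - 1) i - x.1 1 j + η) ≠ 0 := by
    simpa only [sub_self] using hqw
  have hT : ∀ u, monodromy τ η c u x = lax τ η c 1 u x * laxSuffix τ η c u x 1 := fun u => by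
    rw [← laxSuffix_zero, laxSuffix_eq_mul _ _ _ _ _ (NeZero.pos n), Nat.cast_zero, zero_add]
  have hplus : sBrevePlus τ η c z x * in1 (lax τ η c 1 z x) =
      ∑ k, laxDerivLeft τ η c 1 z x k ⊗ₖ diagUnit k := by
    rw [sBrevePlus, Matrix.nonsing_inv_mul_cancel_right _ _ (isUnit_det_in1 hLz),
      in1_lax_mul_sPlus (hqη 1) hqz' hLz]
  have hminus : sBreveMinus τ η c w x * in2 (lax τ η c 1 w x) =
      ∑ k, diagUnit k ⊗ₖ laxDerivLeft τ η c 1 w x k := by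
    rw [sBreveMinus, Matrix.nonsing_inv_mul_cancel_right _ _ (isUnit_det_in2 hLw),
      in2_lax_mul_sMinus (hqη 1) hqw' hLw]
  have hleft : leftTerm τ η c 1 z w x =
      (sBreveMinus τ η c w x - sBrevePlus τ η c z x) * (lax τ η c 1 z x ⊗ₖ lax τ η c 1 w x) := by
    rw [sub_mul, ← in2_mul_in1, ← mul_assoc, hminus, in2_mul_in1, ← in1_mul_in2, ← mul_assoc, hplus]
    simp only [leftTerm, in1, in2, Finset.sum_mul, ← Matrix.mul_kronecker_mul, mul_one,
      Finset.sum_sub_distrib]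
  have hclose : closingTerm τ η c z w x =
      in1 (monodromy τ η c z x) * sBreveMinus τ η c w x * in2 (monodromy τ η c w x) -
        in2 (monodromy τ η c w x) * sBrevePlus τ η c z x * in1 (monodromy τ η c z x) := by
    have e1 : in1 (monodromy τ η c z x) =
        in1 (lax τ η c 1 z x) * in1 (laxSuffix τ η c z x 1) := by
      rw [hT, in1, in1, in1, ← Matrix.mul_kronecker_mul, one_mul]
    have e2 : in2 (monodromy τ η c w x) =
        in2 (lax τ η c 1 w x) * in2 (laxSuffix τ η c w x 1) := by
      rw [hT, in2, in2, in2, ← Matrix.mul_kronecker_mul, one_mul]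
    have h1 : in1 (monodromy τ η c z x) * sBreveMinus τ η c w x * in2 (monodromy τ η c w x) =
        in1 (monodromy τ η c z x) * (∑ k, diagUnit k ⊗ₖ laxDerivLeft τ η c 1 w x k) *
          in2 (laxSuffix τ η c w x 1) := by
      rw [e2, ← hminus]
      simp only [mul_assoc]
    have h2 : in2 (monodromy τ η c w x) * sBrevePlus τ η c z x * in1 (monodromy τ η c z x) =
        in2 (monodromy τ η c w x) * (∑ k, laxDerivLeft τ η c 1 z x k ⊗ₖ diagUnit k) *
          in1 (laxSuffix τ η c z x 1) := by
      rw [e1, ← hplus]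
      simp only [mul_assoc]
    rw [h1, h2]
    simp only [closingTerm, in1, in2, Finset.sum_mul, Finset.mul_sum, ← Matrix.mul_kronecker_mul,
      mul_one, one_mul, Finset.sum_sub_distrib]
  rw [hleft, hclose, mul_assoc _ (lax τ η c 1 z x ⊗ₖ _), ← Matrix.mul_kronecker_mul, ← hT, ← hT,
    ← in1_mul_in2]
  noncomm_ring
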